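/- **Setting.** For a unit vector $u\in\mathbb R^p$ and $\sigma>0$, the binary Gaussian mixture model is the law of $(x,y)$ where $y$ is uniform on $\{-1,+1\}$ and, given $y$, $x\sim\mathcal N(yu,\sigma^2I_p)$. Labeled samples $(x_i^k,y_i^k)_{i\le n_k}$, $y_i^k\in\{-1,1\}$, are held by clients $k=1,\dots,N$; put $n=\sum_k n_k$. In the federated distillation (FD) meta-algorithm client $k$ computes $\beta^k=\frac1{n_k}\sum_{i\le n_k}y_i^kx_i^k$, and the server averages the logits, $t(x)=\sum_k\frac{n_k}{n}(\beta^k)^{T}x=\beta_s^{T}x$, where $\beta_s=\sum_k\frac{n_k}{n}\beta^k$ is the averaged-logit estimator. With unlabeled samples $x_1,\dots,x_m$ and an acceptance threshold $\tau$, the server estimator after distillation is $$\hat\beta_\tau=\frac{\sum_{i=1}^m\mathbf 1(|t(x_i)|>\tau)\,\hat y(t(x_i))\,x_i}{\sum_{i=1}^m\mathbf 1(|t(x_i)|>\tau)},$$ where $\hat y(s)=1$ if $s\ge0$ and $\hat y(s)=-1$ otherwise. Self-training from a vector $\beta$ is the same formula with $\beta^{T}x$ in place of $t(x)$. For vectors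 $a,b$ let $\rho(a,b)=\frac{a^{T}b}{\|a\|\|b\|}$ and $\cot(a,b)=\rho(a,b)/\sqrt{1-\rho(a,b)^2}$. **Theorem 1.** (a) For all labeled data, $\beta_s=\frac1n\sum_k\sum_{i\le n_k}y_i^kx_i^k$, the averaging estimator of the pooled labeled data; hence, for every threshold and every unlabeled sample, the FD server estimator equals the self-training estimator started from the pooled averaging estimator. (b) Fix $\sigma>0$, $\Gamma\ge0$, $\alpha>0$ and $\bar u>0$. Let $p\to\infty$ and let the number $m$ of unlabeled samples satisfy $m/p\to\bar u$ (in particular $m/p=\bar u$ is allowed). For each $p$ in the sequence let $u\in\mathbb R^p$ be a unit vector and let labeled data be given such that $\rho(\beta_s,u)=\alpha$ (the labeled data are considered as fixed). Draw the $m$ unlabeled samples i.i.d. from the Gaussian mixture model and let $\hat\beta$ be the FD server estimator with acceptance threshold $\Gamma\|\beta_s\|$, that is, threshold $\Gamma$ for $\beta_s$ scaled to unit length. Put $\bar\Gamma_-=\frac{\Gamma+\alpha}{\sigma}$, $\bar\Gamma_+=\frac{\Gamma-\alpha}{\sigma}$ and, with $Q(t)=\mathbb P(\mathcal N(0,1)>t)$,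 $$\rho=Q(\bar\Gamma_+)+Q(\bar\Gamma_-),\qquad \nu=\frac{Q(\bar\Gamma_-)}{\rho},\qquad \Lambda=\frac{1}{\sqrt{2\pi}\,\rho}\Bigl(e^{-\bar\Gamma_+^2/2}+e^{-\bar\Gamma_-^2/2}\Bigr).$$ Then $$\cot(\hat\beta,u)\ \xrightarrow{\ \mathbb P\ }\ \frac{1+\sigma\alpha\Lambda-2\nu}{\sigma\sqrt{(1-\alpha^2)\Lambda^2+\frac{1}{\bar u\,\rho}}}.$$ -/

import Mathlib

open MeasureTheory ProbabilityTheory Filter Topology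
open scoped RealInnerProductSpace

noncomputable section

/-- The law of a Rademacher label: `+1` and `-1` with probability `1/2` each. -/
def rademacher : Measure ℝ :=
  (2⁻¹ : ENNReal) • Measure.dirac (1 : ℝ) + (2⁻¹ : ENNReal) • Measure.dirac (-1 : ℝ)

/-- Binary Gaussian mixture model: the joint law of `(x, y)`, where `y` is a Rademacher label
and, given `y`, `x = y u + σ g` with `g` standard Gaussian, i.e. `x ∼ N(y u, σ² I_p)`. -/
def gmm {p : ℕ} (u : EuclideanSpace ℝ (Fin p)) (σ : ℝ) :
    Measure (EuclideanSpace ℝ (Fin p) × ℝ) :=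
  (rademacher.prod (stdGaussian (EuclideanSpace ℝ (Fin p)))).map
    (fun z => (z.1 • u + σ • z.2, z.1))

/-- The law of the features of `m` i.i.d. unlabeled samples from the mixture model. -/
def unlabeledLaw {p : ℕ} (u : EuclideanSpace ℝ (Fin p)) (σ : ℝ) (m : ℕ) :
    Measure (Fin m → EuclideanSpace ℝ (Fin p)) :=
  Measure.pi (fun _ => (gmm u σ).map Prod.fst)

/-- The prediction rule: label `1` if the value of the prediction function is nonnegative,
and `-1` otherwise. -/
def predLabel (t : ℝ) : ℝ := if 0 ≤ t then 1 else -1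

/-- Average of the pseudo-labeled accepted samples: a sample `x i` is accepted when
`|f (x i)| > Γ`, and it gets the label predicted by `f`. -/
def pseudoLabelAverage {p m : ℕ} (f : EuclideanSpace ℝ (Fin p) → ℝ) (Γ : ℝ)
    (x : Fin m → EuclideanSpace ℝ (Fin p)) : EuclideanSpace ℝ (Fin p) :=
  (∑ i, if Γ < |f (x i)| then (1 : ℝ) else 0)⁻¹ •
    ∑ i, (if Γ < |f (x i)| then (1 : ℝ) else 0) • (predLabel (f (x i)) • x i)

/-- Self-training from an initial linear estimator `β` with acceptance threshold `Γ`. -/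
def selfTraining {p m : ℕ} (β : EuclideanSpace ℝ (Fin p)) (Γ : ℝ)
    (x : Fin m → EuclideanSpace ℝ (Fin p)) : EuclideanSpace ℝ (Fin p) :=
  pseudoLabelAverage (fun z => ⟪β, z⟫) Γ x

/-- Labeled data distributed over finitely many clients: client `k` holds the labeled samples
`(x k i, y k i)`, `i < size k`, with labels in `{-1, 1}`. -/
structure FederatedData (p : ℕ) where
  clients : ℕ
  size : Fin clients → ℕ
  x : ∀ k, Fin (size k) → EuclideanSpace ℝ (Fin p)
  y : ∀ k, Fin (size k) → ℝ
  label_mem : ∀ k i, y k i = 1 ∨ y k i = -1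

namespace FederatedData

/-- The total number of labeled samples. -/
def total {p : ℕ} (D : FederatedData p) : ℕ := ∑ k, D.size k

/-- Local update: the averaging estimator of client `k`. -/
def localEstimator {p : ℕ} (D : FederatedData p) (k : Fin D.clients) :
    EuclideanSpace ℝ (Fin p) :=
  (D.size k : ℝ)⁻¹ • ∑ i, D.y k i • D.x k i

/-- Logit computation: the output of the local model of client `k` at `z`. -/
def localLogit {p : ℕ} (D : FederatedData p) (k : Fin D.clients)
    (z : EuclideanSpace ℝ (Fin p)) : ℝ :=
  ⟪D.localEstimator k, z⟫

/-- Logit aggregation: the average of the uploaded logits at `z`, weighted by sample size. -/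
def avgLogit {p : ℕ} (D : FederatedData p) (z : EuclideanSpace ℝ (Fin p)) : ℝ :=
  ∑ k, ((D.size k : ℝ) / (D.total : ℝ)) * D.localLogit k z

/-- The averaged-logit estimator `β_s`: the averaged logits are `z ↦ β_sᵀ z`. -/
def serverVector {p : ℕ} (D : FederatedData p) : EuclideanSpace ℝ (Fin p) :=
  ∑ k, ((D.size k : ℝ) / (D.total : ℝ)) • D.localEstimator k

/-- The averaging estimator of all labeled samples pooled together. -/
def pooledEstimator {p : ℕ} (D : FederatedData p) : EuclideanSpace ℝ (Fin p) :=
  (D.total : ℝ)⁻¹ • ∑ k, ∑ i, D.y k i • D.x k i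

/-- Model distillation: the server estimator computed from the averaged logits on the
unlabeled data `x` with acceptance threshold `Γ`. -/
def fdEstimator {p m : ℕ} (D : FederatedData p) (Γ : ℝ)
    (x : Fin m → EuclideanSpace ℝ (Fin p)) : EuclideanSpace ℝ (Fin p) :=
  pseudoLabelAverage D.avgLogit Γ x

end FederatedData

/-- The correlation (cosine of the angle) of two vectors. -/
def corr {p : ℕ} (a b : EuclideanSpace ℝ (Fin p)) : ℝ := ⟪a, b⟫ / (‖a‖ * ‖b‖)

/-- The cotangent of the angle of two vectors, through their correlation. -/
def cotAngle {p : ℕ} (a b : EuclideanSpace ℝ (Fin p)) : ℝ :=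
  corr a b / √(1 - corr a b ^ 2)

/-- The tail `Q` of the standard normal distribution. -/
def gaussianTail (t : ℝ) : ℝ := (gaussianReal 0 1).real (Set.Ioi t)

/-- The normalized threshold `(Γ - α) / σ`. -/
def thresholdPlus (σ Γ α : ℝ) : ℝ := (Γ - α) / σ

/-- The normalized threshold `(Γ + α) / σ`. -/
def thresholdMinus (σ Γ α : ℝ) : ℝ := (Γ + α) / σ

/-- The limiting acceptance probability `ρ`. -/
def acceptRate (σ Γ α : ℝ) : ℝ :=
  gaussianTail (thresholdPlus σ Γ α) + gaussianTail (thresholdMinus σ Γ α)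

/-- The limiting pseudo-label error rate `ν` among the accepted samples. -/
def errorRate (σ Γ α : ℝ) : ℝ :=
  gaussianTail (thresholdMinus σ Γ α) / acceptRate σ Γ α

/-- The quantity `Λ`. -/
def biasFactor (σ Γ α : ℝ) : ℝ :=
  1 / (√(2 * Real.pi) * acceptRate σ Γ α) *
    (Real.exp (-(thresholdPlus σ Γ α) ^ 2 / 2) + Real.exp (-(thresholdMinus σ Γ α) ^ 2 / 2))

/-- The limiting cotangent. -/
def limitCot (σ Γ α ubar : ℝ) : ℝ :=
  (1 + σ * α * biasFactor σ Γ α - 2 * errorRate σ Γ α) /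
    (σ * √((1 - α ^ 2) * biasFactor σ Γ α ^ 2 + 1 / (ubar * acceptRate σ Γ α)))

end

/-!
The statements on the federated estimator are algebra: averaging logits of linear models with
weights `n_k / n` is averaging the local estimators with these weights, which cancels the local
normalizations.

For the limit of the cotangent, let `b` be the normalization of `β_s` and let
`w = 1(|⟪b, x⟫| > Γ) ŷ(⟪b, x⟫) x` be the contribution of a sample `x` to the numerator of the
estimator (`pseudoVector`). The cotangent does not see positive factors, so the estimator may be
replaced by the empirical mean `W` of the `w i`, and the cotangent is
`⟪W, u⟫ / √(‖W‖ ^ 2 - ⟪W, u⟫ ^ 2)`. As `w` is an even function of `x`, its law is the one obtained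
from the single Gaussian `x = u + σ g` (`map_gmm_of_even`).

*Moments of `w`.* The acceptance and the pseudo-label depend on `g` through `⟪b, g⟫` only, so the
reflection of `g` in the line of `b` gives `𝔼 w = ρ ((1 - 2 ν) u + σ Λ b)`
(`integral_id_pseudoLaw`), with one-dimensional truncated Gaussian moments as coefficients. As
`‖g‖ ^ 2` concentrates around `p`, `𝔼 ‖w‖ ^ 2 = σ² p ρ + O(√p)`
(`abs_integral_norm_sq_pseudoLaw_sub_le`).

*Concentration.* `⟪W, u⟫` obeys the usual law of large numbers. In
`‖W‖ ^ 2 = ‖𝔼 w‖ ^ 2 + 2 ⟪𝔼 w, W - 𝔼 w⟫ + ‖W - 𝔼 w‖ ^ 2` the middle term vanishes in the limit, and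
the last one splits into the diagonal `m⁻² ∑ i, ‖w i - 𝔼 w‖ ^ 2`, which tends to
`lim 𝔼 ‖w‖ ^ 2 / m = σ² ρ / ū`, and the off-diagonal part, whose second moment is `O(p / m²)`
because the directional second moments of `w` are bounded (`offDiagonal_moments`). This is
`tendstoInProb_empiricalMean_vector`. Hence `‖W‖ ^ 2 - ⟪W, u⟫ ^ 2` tends to
`ρ² σ² ((1 - α²) Λ² + 1 / (ū ρ)) > 0`, and the continuous mapping theorem concludes.
-/

/-! ### Convergence in probability to a constant, along a sequence of probability spaces -/

/-- Convergence in probability of the real random variables `X j` to the constant `c`. The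
probability space `(Ω j, P j)` is allowed to change with `j`, which is why
`MeasureTheory.TendstoInMeasure` does not apply. -/
def TendstoInProb {Ω : ℕ → Type*} [∀ j, MeasurableSpace (Ω j)] (P : ∀ j, Measure (Ω j))
    (X : ∀ j, Ω j → ℝ) (c : ℝ) : Prop :=
  ∀ ε, 0 < ε → Tendsto (fun j => P j {ω | ε ≤ |X j ω - c|}) atTop (𝓝 0)

section TendstoInProb

variable {Ω : ℕ → Type*} [∀ j, MeasurableSpace (Ω j)] {P : ∀ j, Measure (Ω j)}

/-- The continuous mapping theorem for two arguments. -/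
lemma TendstoInProb.map₂ {X Y : ∀ j, Ω j → ℝ} {a b : ℝ} {F : ℝ → ℝ → ℝ}
    (hF : ContinuousAt (Function.uncurry F) (a, b))
    (hX : TendstoInProb P X a) (hY : TendstoInProb P Y b) :
    TendstoInProb P (fun j ω => F (X j ω) (Y j ω)) (F a b) := by
  intro ε hε
  obtain ⟨δ, hδ, h⟩ := Metric.continuousAt_iff.1 hF ε hε
  have hsum := (hX δ hδ).add (hY δ hδ)
  rw [add_zero] at hsum
  refine tendsto_of_tendsto_of_tendsto_of_le_of_le tendsto_const_nhds hsum
    (fun _ => zero_le) (fun j => ?_)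
  refine (measure_mono ?_).trans (measure_union_le _ _)
  intro ω hω
  by_contra hcon
  simp only [Set.mem_union, Set.mem_ofPred_eq, not_or, not_le] at hcon hω
  have := h (x := (X j ω, Y j ω)) (by
    rw [Prod.dist_eq, Real.dist_eq, Real.dist_eq]
    exact max_lt hcon.1 hcon.2)
  rw [Real.dist_eq] at this
  exact absurd this (not_lt.2 hω)

lemma tendstoInProb_of_variance [∀ j, IsProbabilityMeasure (P j)] {X : ∀ j, Ω j → ℝ} {c : ℝ}
    (hX : ∀ j, MemLp (X j) 2 (P j)) (hE : Tendsto (fun j => ∫ ω, X j ω ∂(P j)) atTop (𝓝 c))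
    (hV : Tendsto (fun j => Var[X j; P j]) atTop (𝓝 0)) : TendstoInProb P X c := by
  intro ε hε
  have h1 : Tendsto (fun j => ENNReal.ofReal (Var[X j; P j] / (ε / 2) ^ 2)) atTop (𝓝 0) := by
    have := ENNReal.tendsto_ofReal (hV.div_const ((ε / 2) ^ 2))
    simpa using this
  refine tendsto_of_tendsto_of_tendsto_of_le_of_le' tendsto_const_nhds h1
    (Eventually.of_forall fun _ => zero_le) ?_
  filter_upwards [Metric.tendsto_nhds.1 hE (ε / 2) (half_pos hε)] with j hj
  refine le_trans (measure_mono ?_) (meas_ge_le_variance_div_sq (hX j) (half_pos hε))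
  intro ω hω
  rw [Real.dist_eq] at hj
  simp only [Set.mem_ofPred_eq] at hω ⊢
  have := abs_sub_le (X j ω) (∫ ω, X j ω ∂(P j)) c
  linarith

end TendstoInProb

/-! ### Sums of independent centered vectors -/

section Independent

variable {E : Type*} [NormedAddCommGroup E] [InnerProductSpace ℝ E] [FiniteDimensional ℝ E]
  [MeasurableSpace E] [BorelSpace E] {Ω : Type*} [MeasurableSpace Ω] {P : Measure Ω}

lemma integral_inner_of_indepFun {X Y : Ω → E} (h : IndepFun X Y P) (hX : Integrable X P)
    (hY : Integrable Y P) :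
    Integrable (fun ω => ⟪X ω, Y ω⟫) P ∧ ∫ ω, ⟪X ω, Y ω⟫ ∂P = ⟪∫ ω, X ω ∂P, ∫ ω, Y ω ∂P⟫ :=
  ⟨h.integrable_bilin hX hY (innerSL ℝ), h.integral_bilin hX hY (innerSL ℝ)⟩

lemma integral_inner_sq_le_of_indepFun [IsProbabilityMeasure P] {S X : Ω → E}
    (h : IndepFun S X P) (hS : Measurable S)
    (hX : Measurable X) (hS2 : MemLp S 2 P) (hX2 : MemLp X 2 P) {C : ℝ}
    (hC : ∀ v : E, ∫ ω, ⟪v, X ω⟫ ^ 2 ∂P ≤ C * ‖v‖ ^ 2) :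
    MemLp (fun ω => ⟪S ω, X ω⟫) 2 P ∧ ∫ ω, ⟪S ω, X ω⟫ ^ 2 ∂P ≤ C * ∫ ω, ‖S ω‖ ^ 2 ∂P := by
  have hmeas : Measurable (fun ω => ⟪S ω, X ω⟫) := hS.inner hX
  have hint : Integrable (fun ω => ⟪S ω, X ω⟫ ^ 2) P := by
    have hi : Integrable ((fun ω => ‖S ω‖ ^ 2) * (fun ω => ‖X ω‖ ^ 2)) P :=
      IndepFun.integrable_mul
        (h.comp (measurable_norm.pow_const 2) (measurable_norm.pow_const 2))
        (hS2.integrable_norm_pow two_ne_zero) (hX2.integrable_norm_pow two_ne_zero)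
    refine hi.mono' (hmeas.pow_const 2).aestronglyMeasurable (Eventually.of_forall fun ω => ?_)
    simp only [Real.norm_eq_abs, abs_pow, Pi.mul_apply, ← mul_pow]
    gcongr
    exact abs_real_inner_le_norm _ _
  refine ⟨(memLp_two_iff_integrable_sq hmeas.aestronglyMeasurable).2 hint, ?_⟩
  have hprod := (indepFun_iff_map_prod_eq_prod_map_map hS.aemeasurable hX.aemeasurable).1 h
  have hPS : IsProbabilityMeasure (P.map S) := Measure.isProbabilityMeasure_map hS.aemeasurable
  have hPX : IsProbabilityMeasure (P.map X) := Measure.isProbabilityMeasure_map hX.aemeasurable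
  have hg : Measurable (fun z : E × E => ⟪z.1, z.2⟫ ^ 2) :=
    (measurable_fst.inner measurable_snd).pow_const 2
  have hint' : Integrable (fun z : E × E => ⟪z.1, z.2⟫ ^ 2) ((P.map S).prod (P.map X)) := by
    rw [← hprod]
    exact (integrable_map_measure hg.aestronglyMeasurable (hS.prodMk hX).aemeasurable).2 hint
  have hSsq : Integrable (fun s : E => ‖s‖ ^ 2) (P.map S) :=
    (integrable_map_measure (by fun_prop) hS.aemeasurable).2
      (hS2.integrable_norm_pow two_ne_zero)
  calc ∫ ω, ⟪S ω, X ω⟫ ^ 2 ∂P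
      = ∫ z : E × E, ⟪z.1, z.2⟫ ^ 2 ∂((P.map S).prod (P.map X)) := by
        rw [← hprod, integral_map (hS.prodMk hX).aemeasurable hg.aestronglyMeasurable]
    _ = ∫ s, ∫ x, ⟪s, x⟫ ^ 2 ∂(P.map X) ∂(P.map S) := integral_prod _ hint'
    _ ≤ ∫ s, C * ‖s‖ ^ 2 ∂(P.map S) := by
        refine integral_mono hint'.integral_prod_left (hSsq.const_mul C) fun s => ?_
        simp only
        rw [integral_map hX.aemeasurable (by fun_prop)]
        exact hC s
    _ = C * ∫ ω, ‖S ω‖ ^ 2 ∂P := by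
        rw [integral_const_mul, integral_map hS.aemeasurable (by fun_prop)]

/-- For independent centered vectors, the off-diagonal part `∑ i ≠ j, ⟪X i, X j⟫` of the squared
norm of the sum is centered, and its second moment is controlled by the directional second moments
`C` and the total second moment `V`. Adding the index `a` adds `2 ⟪∑ i ∈ s, X i, X a⟫`, which is
uncorrelated with the previous value. -/
lemma offDiagonal_moments [IsProbabilityMeasure P] {ι : Type*} {X : ι → Ω → E}
    (hind : iIndepFun X P)
    (hmeas : ∀ i, Measurable (X i)) (hL2 : ∀ i, MemLp (X i) 2 P) (h0 : ∀ i, ∫ ω, X i ω ∂P = 0)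
    {C V : ℝ} (hC0 : 0 ≤ C) (hC : ∀ i (v : E), ∫ ω, ⟪v, X i ω⟫ ^ 2 ∂P ≤ C * ‖v‖ ^ 2)
    (hV : ∀ i, ∫ ω, ‖X i ω‖ ^ 2 ∂P ≤ V) (s : Finset ι) :
    MemLp (fun ω => ‖∑ i ∈ s, X i ω‖ ^ 2 - ∑ i ∈ s, ‖X i ω‖ ^ 2) 2 P ∧
    ∫ ω, (‖∑ i ∈ s, X i ω‖ ^ 2 - ∑ i ∈ s, ‖X i ω‖ ^ 2) ∂P = 0 ∧
    ∫ ω, (‖∑ i ∈ s, X i ω‖ ^ 2 - ∑ i ∈ s, ‖X i ω‖ ^ 2) ^ 2 ∂P ≤ 2 * C * V * (s.card : ℝ) ^ 2 := by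
  classical
  induction s using Finset.induction_on with
  | empty => simp
  | insert a s ha ih =>
    obtain ⟨hT2, hT0, hTV⟩ := ih
    set S : Ω → E := fun ω => ∑ i ∈ s, X i ω with hSdef
    set T : Ω → ℝ := fun ω => ‖∑ i ∈ s, X i ω‖ ^ 2 - ∑ i ∈ s, ‖X i ω‖ ^ 2 with hTdef
    have hSm : Measurable S := Finset.measurable_fun_sum _ fun i _ => hmeas i
    have hS2 : MemLp S 2 P := memLp_finsetSum _ fun i _ => hL2 i
    have hSX : IndepFun (fun ω => (T ω, S ω)) (X a) P := by
      have h := hind.indepFun_finset s {a} (Finset.disjoint_singleton_right.2 ha) hmeas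
      have hψ : Measurable fun x : ({a} : Finset ι) → E => x ⟨a, Finset.mem_singleton_self a⟩ :=
        measurable_pi_apply _
      have h' := h.comp
        (φ := fun x : s → E => (‖∑ i, x i‖ ^ 2 - ∑ i, ‖x i‖ ^ 2, ∑ i, x i)) (by fun_prop) hψ
      convert h' using 1
      ext ω
      · simp only [hTdef, Function.comp]
        rw [Finset.sum_coe_sort s (fun i => X i ω), Finset.sum_coe_sort s (fun i => ‖X i ω‖ ^ 2)]
      · simp only [hSdef, Function.comp]
        rw [Finset.sum_coe_sort s (fun i => X i ω)]
      · rfl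
    have hSind : IndepFun S (X a) P := hSX.comp measurable_snd measurable_id
    have hTSind : IndepFun (fun ω => T ω • S ω) (X a) P :=
      hSX.comp (measurable_fst.smul measurable_snd) measurable_id
    have hXa := (hL2 a).integrable one_le_two
    obtain ⟨hSa1, hSa2⟩ := integral_inner_of_indepFun hSind (hS2.integrable one_le_two) hXa
    have hTSi : Integrable (fun ω => T ω • S ω) P :=
      memLp_one_iff_integrable.1 (hS2.smul (r := 1) hT2)
    obtain ⟨hTSa1, hTSa2⟩ := integral_inner_of_indepFun hTSind hTSi hXa
    obtain ⟨hq1, hq2⟩ := integral_inner_sq_le_of_indepFun hSind hSm (hmeas a) hS2 (hL2 a) (hC a)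
    rw [h0 a, inner_zero_right] at hSa2 hTSa2
    have hSnorm : ∫ ω, ‖S ω‖ ^ 2 ∂P ≤ s.card * V := by
      have e : ∀ ω, ‖S ω‖ ^ 2 = T ω + ∑ i ∈ s, ‖X i ω‖ ^ 2 := fun ω => by simp [hTdef, hSdef]
      simp_rw [e]
      rw [integral_add (hT2.integrable one_le_two)
        (integrable_finsetSum _ fun i _ => (hL2 i).integrable_norm_pow two_ne_zero), hT0, zero_add,
        integral_finsetSum _ fun i _ => (hL2 i).integrable_norm_pow two_ne_zero,
        ← nsmul_eq_mul]
      exact Finset.sum_le_card_nsmul _ _ _ fun i _ => hV i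
    have key : ∀ ω, ‖∑ i ∈ insert a s, X i ω‖ ^ 2 - ∑ i ∈ insert a s, ‖X i ω‖ ^ 2
        = T ω + 2 * ⟪S ω, X a ω⟫ := fun ω => by
      rw [Finset.sum_insert ha, Finset.sum_insert ha, add_comm (X a ω), norm_add_sq_real]
      simp only [hTdef, hSdef]; ring
    simp_rw [key]
    refine ⟨hT2.add (hq1.const_mul 2), ?_, ?_⟩
    · rw [integral_add (hT2.integrable one_le_two) (hSa1.const_mul 2), integral_const_mul, hT0,
        hSa2]
      simp
    · have e : ∀ ω, (T ω + 2 * ⟪S ω, X a ω⟫) ^ 2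
          = T ω ^ 2 + (4 * ⟪T ω • S ω, X a ω⟫ + 4 * ⟪S ω, X a ω⟫ ^ 2) := fun ω => by
        rw [real_inner_smul_left]; ring
      simp_rw [e]
      have hi : Integrable (fun ω => 4 * ⟪T ω • S ω, X a ω⟫ + 4 * ⟪S ω, X a ω⟫ ^ 2) P :=
        (hTSa1.const_mul 4).add (hq1.integrable_sq.const_mul 4)
      rw [integral_add hT2.integrable_sq hi,
        integral_add (hTSa1.const_mul 4) (hq1.integrable_sq.const_mul 4),
        integral_const_mul, integral_const_mul, hTSa2, Finset.card_insert_of_notMem ha]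
      have hV0 : 0 ≤ V := (integral_nonneg fun ω => by positivity).trans (hV a)
      have := mul_le_mul_of_nonneg_left hSnorm hC0
      push_cast
      nlinarith [mul_nonneg hC0 hV0]

end Independent

/-! ### Empirical means of independent vectors in growing dimension -/

lemma TendstoInProb.congr' {Ω : ℕ → Type*} [∀ j, MeasurableSpace (Ω j)] {P : ∀ j, Measure (Ω j)}
    {X Y : ∀ j, Ω j → ℝ} {c : ℝ} (hX : TendstoInProb P X c) (h : ∀ᶠ j in atTop, X j = Y j) :
    TendstoInProb P Y c := fun ε hε =>
  (hX ε hε).congr' (h.mono fun j hj => by simp only [hj])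

section EmpiricalMean

lemma empiricalMean_moments {E : Type*} [MeasurableSpace E] {ν : Measure E}
    [IsProbabilityMeasure ν] {f : E → ℝ} (hf : MemLp f 2 ν) (m : ℕ) :
    MemLp (fun w : Fin m → E => (m : ℝ)⁻¹ * ∑ i, f (w i)) 2 (Measure.pi fun _ => ν) ∧
    (0 < m → ∫ w : Fin m → E, (m : ℝ)⁻¹ * ∑ i, f (w i) ∂(Measure.pi fun _ => ν) = ∫ x, f x ∂ν) ∧
    Var[fun w : Fin m → E => (m : ℝ)⁻¹ * ∑ i, f (w i); Measure.pi fun _ => ν]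
      = Var[f; ν] / m := by
  have hi : ∀ i : Fin m, MemLp (fun w : Fin m → E => f (w i)) 2 (Measure.pi fun _ => ν) :=
    fun i => hf.comp_measurePreserving (measurePreserving_eval (fun _ => ν) i)
  refine ⟨(memLp_finsetSum _ fun i _ => hi i).const_mul _, fun hm => ?_, ?_⟩
  · rw [integral_const_mul, integral_finsetSum _ fun i _ => (hi i).integrable one_le_two]
    simp_rw [integral_comp_eval (μ := fun _ : Fin m => ν) hf.aestronglyMeasurable]
    have : (m : ℝ) ≠ 0 := by positivity
    simp [this]
  · rw [variance_const_mul]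
    have := variance_sum_pi (μ := fun _ : Fin m => ν) (X := fun _ => f) fun _ => hf
    have e : (∑ i : Fin m, fun w : Fin m → E => f (w i)) = fun w => ∑ i, f (w i) := by
      ext w; simp
    rw [e] at this
    rw [this]
    rcases Nat.eq_zero_or_pos m with rfl | hm
    · simp
    · simp; field_simp

lemma tendstoInProb_empiricalMean {E : ℕ → Type*} [∀ j, MeasurableSpace (E j)]
    {ν : ∀ j, Measure (E j)} [∀ j, IsProbabilityMeasure (ν j)] {m : ℕ → ℕ}
    (hm : Tendsto m atTop atTop) {f : ∀ j, E j → ℝ} (hf : ∀ j, MemLp (f j) 2 (ν j)) {c : ℝ}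
    (hE : Tendsto (fun j => ∫ x, f j x ∂(ν j)) atTop (𝓝 c))
    (hV : Tendsto (fun j => Var[f j; ν j] / m j) atTop (𝓝 0)) :
    TendstoInProb (fun j => Measure.pi fun _ : Fin (m j) => ν j)
      (fun j w => (m j : ℝ)⁻¹ * ∑ i, f j (w i)) c := by
  refine tendstoInProb_of_variance (fun j => (empiricalMean_moments (hf j) (m j)).1) ?_ ?_
  · refine hE.congr' ?_
    filter_upwards [hm.eventually_gt_atTop 0] with j hj
    exact ((empiricalMean_moments (hf j) (m j)).2.1 hj).symm
  · simpa only [(empiricalMean_moments (hf _) (m _)).2.2] using hV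

/-- Expansion of the squared norm of an empirical mean around the mean `a`, with the diagonal and
off-diagonal terms of the fluctuation kept apart. -/
lemma norm_sq_empiricalMean {E : Type*} [NormedAddCommGroup E] [InnerProductSpace ℝ E]
    {m : ℕ} (hm : 0 < m) (a : E) (w : Fin m → E) :
    ‖(m : ℝ)⁻¹ • ∑ i, w i‖ ^ 2 = (2 * ((m : ℝ)⁻¹ * ∑ i, ⟪a, w i⟫) - ‖a‖ ^ 2)
      + ((m : ℝ)⁻¹ * ∑ i, (m : ℝ)⁻¹ * ‖w i - a‖ ^ 2
        + ((m : ℝ) ^ 2)⁻¹ * (‖∑ i, (w i - a)‖ ^ 2 - ∑ i, ‖w i - a‖ ^ 2)) := by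
  have hm' : (m : ℝ) ≠ 0 := by positivity
  have h1 : ∑ i, (w i - a) = (m : ℝ) • ((m : ℝ)⁻¹ • ∑ i, w i - a) := by
    rw [smul_sub, smul_inv_smul₀ hm', Finset.sum_sub_distrib]
    simp [Nat.cast_smul_eq_nsmul]
  have h2 : ∑ i, ⟪a, w i⟫ = (m : ℝ) * ⟪a, (m : ℝ)⁻¹ • ∑ i, w i⟫ := by
    rw [real_inner_smul_right, inner_sum, mul_inv_cancel_left₀ hm']
  rw [h1, h2, ← Finset.mul_sum, norm_smul (m : ℝ), mul_pow,
    norm_sub_sq_real ((m : ℝ)⁻¹ • ∑ i, w i), real_inner_comm a]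
  simp only [Real.norm_eq_abs, sq_abs]
  field_simp
  ring

section Vector

variable {E : Type*} [NormedAddCommGroup E] [InnerProductSpace ℝ E] [MeasurableSpace E]
  {ν : Measure E}

lemma memLp_inner_left {q : ENNReal} (h : MemLp id q ν) (v : E) :
    MemLp (fun x => ⟪v, x⟫) q ν :=
  h.continuousLinearMap_comp (innerSL ℝ v)

variable [FiniteDimensional ℝ E] [IsProbabilityMeasure ν]

lemma integral_inner_left (h : MemLp id 2 ν) (v : E) :
    ∫ x, ⟪v, x⟫ ∂ν = ⟪v, ∫ x, x ∂ν⟫ :=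
  (innerSL ℝ v).integral_comp_comm (h.integrable one_le_two)

lemma integral_inner_sub_mean_sq_le (h : MemLp id 2 ν) (v : E) :
    ∫ x, ⟪v, x - ∫ y, y ∂ν⟫ ^ 2 ∂ν ≤ ∫ x, ⟪v, x⟫ ^ 2 ∂ν := by
  have h1 := variance_eq_integral (memLp_inner_left h v).aestronglyMeasurable.aemeasurable
  have h2 := variance_le_expectation_sq (memLp_inner_left h v).aestronglyMeasurable
  rw [integral_inner_left h] at h1
  simp_rw [inner_sub_right]
  rw [← h1]
  simpa using h2

lemma integral_norm_sub_mean_sq (h : MemLp id 2 ν) :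
    ∫ x, ‖x - ∫ y, y ∂ν‖ ^ 2 ∂ν = ∫ x, ‖x‖ ^ 2 ∂ν - ‖∫ y, y ∂ν‖ ^ 2 := by
  have hi : Integrable (fun x : E => ‖x‖ ^ 2) ν := h.integrable_norm_pow two_ne_zero
  have hl := (memLp_inner_left h (∫ y, y ∂ν)).integrable one_le_two
  have e : ∀ x : E, ‖x - ∫ y, y ∂ν‖ ^ 2
      = ‖x‖ ^ 2 - 2 * ⟪∫ y, y ∂ν, x⟫ + ‖∫ y, y ∂ν‖ ^ 2 := fun x => by
    rw [norm_sub_sq_real, real_inner_comm]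
  simp_rw [e]
  rw [integral_add (f := fun x => ‖x‖ ^ 2 - 2 * ⟪∫ y, y ∂ν, x⟫) (hi.sub (hl.const_mul 2))
      (integrable_const _), integral_sub hi (hl.const_mul 2), integral_const_mul,
    integral_inner_left h, real_inner_self_eq_norm_sq]
  simp; ring

variable [BorelSpace E]

lemma variance_norm_sub_sq_le (h : MemLp id 4 ν) (a : E) :
    MemLp (fun x => ‖x - a‖ ^ 2) 2 ν ∧
    Var[fun x => ‖x - a‖ ^ 2; ν] ≤ 8 * (∫ x, ‖x‖ ^ 4 ∂ν + ‖a‖ ^ 4) := by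
  have hi : Integrable (fun x : E => ‖x‖ ^ 4) ν := h.integrable_norm_pow four_ne_zero
  have hm : AEStronglyMeasurable (fun x : E => ‖x - a‖ ^ 2) ν := by fun_prop
  have hb : ∀ x : E, (‖x - a‖ ^ 2) ^ 2 ≤ 8 * (‖x‖ ^ 4 + ‖a‖ ^ 4) := fun x => by
    have h1 : ‖x - a‖ ^ 4 ≤ (‖x‖ + ‖a‖) ^ 4 := by gcongr; exact norm_sub_le _ _
    have h2 := add_pow_le (norm_nonneg x) (norm_nonneg a) 4
    norm_num at h2
    calc (‖x - a‖ ^ 2) ^ 2 = ‖x - a‖ ^ 4 := by ring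
      _ ≤ _ := h1.trans h2
  have hj : Integrable (fun x : E => 8 * (‖x‖ ^ 4 + ‖a‖ ^ 4)) ν :=
    (hi.add (integrable_const _)).const_mul 8
  have hs : Integrable (fun x : E => (‖x - a‖ ^ 2) ^ 2) ν :=
    hj.mono' (by fun_prop) (Eventually.of_forall fun x => by
      rw [Real.norm_of_nonneg (by positivity)]; exact hb x)
  refine ⟨(memLp_two_iff_integrable_sq hm).2 hs, ?_⟩
  refine (variance_le_expectation_sq hm).trans ((integral_mono hs hj hb).trans ?_)
  rw [integral_const_mul, integral_add hi (integrable_const _)]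
  simp

lemma offDiagonal_empirical (h2 : MemLp id 2 ν) {C : ℝ} (hC0 : 0 ≤ C)
    (hC : ∀ v, ∫ x, ⟪v, x⟫ ^ 2 ∂ν ≤ C * ‖v‖ ^ 2) (m : ℕ) :
    MemLp (fun w : Fin m → E => ‖∑ i, (w i - ∫ y, y ∂ν)‖ ^ 2 - ∑ i, ‖w i - ∫ y, y ∂ν‖ ^ 2) 2
      (Measure.pi fun _ => ν) ∧
    ∫ w : Fin m → E, (‖∑ i, (w i - ∫ y, y ∂ν)‖ ^ 2 - ∑ i, ‖w i - ∫ y, y ∂ν‖ ^ 2)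
      ∂(Measure.pi fun _ => ν) = 0 ∧
    ∫ w : Fin m → E, (‖∑ i, (w i - ∫ y, y ∂ν)‖ ^ 2 - ∑ i, ‖w i - ∫ y, y ∂ν‖ ^ 2) ^ 2
      ∂(Measure.pi fun _ => ν) ≤ 2 * C * (∫ x, ‖x‖ ^ 2 ∂ν) * (m : ℝ) ^ 2 := by
  set a := ∫ y, y ∂ν with ha
  have hmp := fun i : Fin m => measurePreserving_eval (fun _ : Fin m => ν) i
  have hL : MemLp (fun x : E => x - a) 2 ν := h2.sub (memLp_const a)
  have := offDiagonal_moments (P := Measure.pi fun _ : Fin m => ν)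
    (X := fun i (w : Fin m → E) => w i - a) (C := C) (V := ∫ x, ‖x‖ ^ 2 ∂ν)
    (iIndepFun_pi (μ := fun _ : Fin m => ν) (X := fun _ x => x - a) fun _ => by fun_prop)
    (fun i => by fun_prop) (fun i => hL.comp_measurePreserving (hmp i))
    (fun i => by
      rw [integral_comp_eval (μ := fun _ : Fin m => ν) (f := fun x => x - a) (by fun_prop),
        integral_sub (f := fun x => x) (h2.integrable one_le_two) (integrable_const _)]
      simp [ha])
    hC0
    (fun i v => by
      rw [integral_comp_eval (μ := fun _ : Fin m => ν) (f := fun x => ⟪v, x - a⟫ ^ 2)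
        (by fun_prop)]
      exact (integral_inner_sub_mean_sq_le h2 v).trans (hC v))
    (fun i => by
      rw [integral_comp_eval (μ := fun _ : Fin m => ν) (f := fun x => ‖x - a‖ ^ 2) (by fun_prop),
        integral_norm_sub_mean_sq h2]
      linarith [sq_nonneg ‖∫ y, y ∂ν‖])
    Finset.univ
  simpa using this

end Vector

/-- Laws of large numbers for the empirical mean `W` of `m` independent vectors in a space of
growing dimension: `⟪W, u⟫` concentrates at the value for the mean vector, but `‖W‖ ^ 2` has the
extra limit `q` of the averaged noise energy `𝔼 ‖w‖ ^ 2 / m`. -/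
theorem tendstoInProb_empiricalMean_vector {E : ℕ → Type*} [∀ j, NormedAddCommGroup (E j)]
    [∀ j, InnerProductSpace ℝ (E j)] [∀ j, FiniteDimensional ℝ (E j)]
    [∀ j, MeasurableSpace (E j)] [∀ j, BorelSpace (E j)]
    {ν : ∀ j, Measure (E j)} [∀ j, IsProbabilityMeasure (ν j)] {m : ℕ → ℕ}
    (hm : Tendsto m atTop atTop) {u : ∀ j, E j} (hu : ∀ j, ‖u j‖ = 1) {C c₁ c₂ q : ℝ}
    (h4 : ∀ j, MemLp id 4 (ν j)) (hC0 : 0 ≤ C)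
    (hC : ∀ j v, ∫ x, ⟪v, x⟫ ^ 2 ∂(ν j) ≤ C * ‖v‖ ^ 2)
    (hc₁ : ∀ j, ⟪u j, ∫ x, x ∂(ν j)⟫ = c₁) (hc₂ : ∀ j, ‖∫ x, x ∂(ν j)‖ ^ 2 = c₂)
    (hq : Tendsto (fun j => (∫ x, ‖x‖ ^ 2 ∂(ν j)) / m j) atTop (𝓝 q))
    (hq4 : Tendsto (fun j => (∫ x, ‖x‖ ^ 4 ∂(ν j)) / (m j : ℝ) ^ 3) atTop (𝓝 0)) :
    TendstoInProb (fun j => Measure.pi fun _ : Fin (m j) => ν j)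
      (fun j w => ⟪u j, (m j : ℝ)⁻¹ • ∑ i, w i⟫) c₁ ∧
    TendstoInProb (fun j => Measure.pi fun _ : Fin (m j) => ν j)
      (fun j w => ‖(m j : ℝ)⁻¹ • ∑ i, w i‖ ^ 2) (c₂ + q) := by
  have hmR : Tendsto (fun j => (m j : ℝ)) atTop atTop := tendsto_natCast_atTop_atTop.comp hm
  have hinv : Tendsto (fun j => (m j : ℝ)⁻¹) atTop (𝓝 0) := hmR.inv_tendsto_atTop
  have h2 : ∀ j, MemLp id 2 (ν j) := fun j => (h4 j).mono_exponent (by norm_num)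
  -- empirical means of linear functionals of bounded norm concentrate
  have hlin : ∀ (v : ∀ j, E j) (R c : ℝ), (∀ j, ‖v j‖ ^ 2 = R) →
      (∀ j, ⟪v j, ∫ x, x ∂(ν j)⟫ = c) →
      TendstoInProb (fun j => Measure.pi fun _ : Fin (m j) => ν j)
        (fun j w => (m j : ℝ)⁻¹ * ∑ i, ⟪v j, w i⟫) c := by
    intro v R c hR hc
    refine tendstoInProb_empiricalMean (f := fun j x => ⟪v j, x⟫) hm
      (fun j => memLp_inner_left (h2 j) (v j)) ?_ ?_
    · simp_rw [integral_inner_left (h2 _), hc]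
      exact tendsto_const_nhds
    · have hb : Tendsto (fun j => C * R * (m j : ℝ)⁻¹) atTop (𝓝 0) := by
        simpa using hinv.const_mul (C * R)
      refine squeeze_zero (fun j => div_nonneg (variance_nonneg _ _) (Nat.cast_nonneg _))
        (fun j => ?_) hb
      rw [div_eq_mul_inv]
      gcongr
      rw [← hR j]
      refine le_trans ?_ (hC j (v j))
      exact variance_le_expectation_sq (memLp_inner_left (h2 j) (v j)).aestronglyMeasurable
  refine ⟨?_, ?_⟩
  · simpa only [real_inner_smul_right, inner_sum] using hlin u 1 c₁ (fun j => by simp [hu j]) hc₁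
  have hmean := hlin (fun j => ∫ x, x ∂(ν j)) c₂ c₂ hc₂
    (fun j => by rw [real_inner_self_eq_norm_sq, hc₂ j])
  have hdiag : TendstoInProb (fun j => Measure.pi fun _ : Fin (m j) => ν j)
      (fun j w => (m j : ℝ)⁻¹ * ∑ i, (m j : ℝ)⁻¹ * ‖w i - ∫ x, x ∂(ν j)‖ ^ 2) q := by
    refine tendstoInProb_empiricalMean (f := fun j x => (m j : ℝ)⁻¹ * ‖x - ∫ x, x ∂(ν j)‖ ^ 2) hm
      (fun j => (variance_norm_sub_sq_le (h4 j) _).1.const_mul _) ?_ ?_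
    · simp_rw [integral_const_mul, integral_norm_sub_mean_sq (h2 _), hc₂]
      have : Tendsto (fun j => (∫ x, ‖x‖ ^ 2 ∂(ν j)) / m j - c₂ * (m j : ℝ)⁻¹) atTop
          (𝓝 (q - c₂ * 0)) := hq.sub (hinv.const_mul c₂)
      rw [mul_zero, sub_zero] at this
      exact this.congr fun j => by ring
    · have hb : Tendsto (fun j => 8 * ((∫ x, ‖x‖ ^ 4 ∂(ν j)) / (m j : ℝ) ^ 3
          + c₂ ^ 2 * (m j : ℝ)⁻¹ ^ 3)) atTop (𝓝 0) := by
        simpa using (hq4.add ((hinv.pow 3).const_mul (c₂ ^ 2))).const_mul 8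
      refine squeeze_zero (fun j => div_nonneg (variance_nonneg _ _) (Nat.cast_nonneg _))
        (fun j => ?_) hb
      rw [variance_const_mul]
      have := (variance_norm_sub_sq_le (h4 j) (∫ x, x ∂(ν j))).2
      rw [show ‖∫ x, x ∂(ν j)‖ ^ 4 = c₂ ^ 2 by rw [← hc₂ j]; ring] at this
      calc _ ≤ (m j : ℝ)⁻¹ ^ 2 * (8 * (∫ x, ‖x‖ ^ 4 ∂(ν j) + c₂ ^ 2)) / m j := by gcongr
        _ = _ := by ring
  have hoff : TendstoInProb (fun j => Measure.pi fun _ : Fin (m j) => ν j)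
      (fun j w => ((m j : ℝ) ^ 2)⁻¹ * (‖∑ i, (w i - ∫ x, x ∂(ν j))‖ ^ 2
        - ∑ i, ‖w i - ∫ x, x ∂(ν j)‖ ^ 2)) 0 := by
    have H := fun j => offDiagonal_empirical (h2 j) hC0 (hC j) (m j)
    refine tendstoInProb_of_variance (fun j => (H j).1.const_mul _) ?_ ?_
    · simp_rw [integral_const_mul, (H _).2.1, mul_zero]
      exact tendsto_const_nhds
    · have hb : Tendsto (fun j => 2 * C * ((∫ x, ‖x‖ ^ 2 ∂(ν j)) / m j) * (m j : ℝ)⁻¹) atTop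
          (𝓝 0) := by
        simpa using (hq.const_mul (2 * C)).mul hinv
      refine squeeze_zero' (Eventually.of_forall fun j => variance_nonneg _ _) ?_ hb
      filter_upwards [hm.eventually_gt_atTop 0] with j hj
      rw [variance_const_mul]
      have hle := (variance_le_expectation_sq (H j).1.aestronglyMeasurable).trans (H j).2.2
      calc _ ≤ ((m j : ℝ) ^ 2)⁻¹ ^ 2 * (2 * C * (∫ x, ‖x‖ ^ 2 ∂(ν j)) * (m j : ℝ) ^ 2) := by
            gcongr
        _ = _ := by field_simp
  have hsum := (hmean.map₂ (F := fun x y => (2 * x - c₂) + y) (by fun_prop)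
    (hdiag.map₂ (F := fun x y => x + y) (by fun_prop) hoff))
  rw [show 2 * c₂ - c₂ + (q + 0) = c₂ + q by ring] at hsum
  refine hsum.congr' ?_
  filter_upwards [hm.eventually_gt_atTop 0] with j hj
  ext w
  rw [norm_sq_empiricalMean hj (∫ x, x ∂(ν j)) w, hc₂ j]

end EmpiricalMean

/-! ### One-dimensional truncated Gaussian moments -/

lemma gaussianTail_pos (t : ℝ) : 0 < gaussianTail t := by
  have := (gaussianReal_absolutelyContinuous' 0 one_ne_zero).isOpenPosMeasure
  exact ENNReal.toReal_pos (isOpen_Ioi.measure_pos _ Set.nonempty_Ioi).ne' (measure_ne_top _ _)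

lemma acceptRate_pos (σ Γ α : ℝ) : 0 < acceptRate σ Γ α :=
  add_pos (gaussianTail_pos _) (gaussianTail_pos _)

lemma integral_indicator_Ioi_gaussianReal (a : ℝ) :
    ∫ z, (Set.Ioi a).indicator 1 z ∂(gaussianReal 0 1) = gaussianTail a := by
  rw [integral_indicator_one measurableSet_Ioi]; rfl

/-- The truncated first moment of a standard Gaussian is its density at the truncation point,
because `-φ` is an antiderivative of `z φ(z)`. -/
lemma integral_indicator_Ioi_mul_gaussianReal (a : ℝ) :
    ∫ z, (Set.Ioi a).indicator 1 z * z ∂(gaussianReal 0 1)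
      = 1 / √(2 * Real.pi) * Real.exp (-a ^ 2 / 2) := by
  have hi : Integrable (fun x : ℝ => x * Real.exp (-x ^ 2 / 2)) := by
    refine (integrable_mul_exp_neg_mul_sq (b := 1 / 2) (by norm_num)).congr
      (Eventually.of_forall fun x => ?_)
    simp only
    ring_nf
  have hd : ∀ x : ℝ,
      HasDerivAt (fun x => -Real.exp (-x ^ 2 / 2)) (x * Real.exp (-x ^ 2 / 2)) x := by
    intro x
    have h := (((hasDerivAt_id x).pow 2).neg.div_const 2).exp.neg
    convert! h using 1
    simp; ring
  have hlim : Tendsto (fun x : ℝ => -Real.exp (-x ^ 2 / 2)) atTop (𝓝 0) := by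
    have h1 : Tendsto (fun x : ℝ => -x ^ 2 / 2) atTop atBot := by
      have := (tendsto_pow_atTop (α := ℝ) two_ne_zero).const_mul_atTop_of_neg
        (r := -1 / 2) (by norm_num)
      exact this.congr fun x => by ring
    simpa using (Real.tendsto_exp_atBot.comp h1).neg
  have hint := integral_Ioi_of_hasDerivAt_of_tendsto (a := a)
    (hd a).continuousAt.continuousWithinAt (fun x _ => hd x) hi.integrableOn hlim
  rw [integral_gaussianReal_eq_integral_smul one_ne_zero]
  have e : (fun z => gaussianPDFReal 0 1 z • ((Set.Ioi a).indicator 1 z * z))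
      = (Set.Ioi a).indicator (fun z => 1 / √(2 * Real.pi) * (z * Real.exp (-z ^ 2 / 2))) := by
    ext z
    by_cases hz : z ∈ Set.Ioi a
    · simp [hz, gaussianPDFReal]; ring
    · simp [hz]
  rw [e, integral_indicator measurableSet_Ioi, integral_const_mul, hint]
  ring

lemma integral_comp_neg_gaussianReal {f : ℝ → ℝ} (hf : Measurable f) :
    ∫ z, f (-z) ∂(gaussianReal 0 1) = ∫ z, f z ∂(gaussianReal 0 1) := by
  have h := gaussianReal_map_neg (μ := 0) (v := 1)
  rw [neg_zero] at h
  conv_rhs => rw [← h]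
  rw [integral_map (by fun_prop) hf.aestronglyMeasurable]

/-- The weight given by self-training to a sample with logit `t` and threshold `Γ`: the
pseudo-label if the sample is accepted, and `0` otherwise. -/
noncomputable def pseudoWeight (Γ t : ℝ) : ℝ := if Γ < |t| then predLabel t else 0

lemma measurable_pseudoWeight (Γ : ℝ) : Measurable (pseudoWeight Γ) := by
  unfold pseudoWeight predLabel
  refine Measurable.ite (measurableSet_lt measurable_const (by fun_prop)) ?_ measurable_const
  exact Measurable.ite (measurableSet_le measurable_const measurable_id) measurable_const
    measurable_const

lemma abs_pseudoWeight_le (Γ t : ℝ) : |pseudoWeight Γ t| ≤ 1 := by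
  unfold pseudoWeight predLabel; split_ifs <;> simp

lemma pseudoWeight_neg {Γ : ℝ} (hΓ : 0 ≤ Γ) (t : ℝ) : pseudoWeight Γ (-t) = -pseudoWeight Γ t := by
  unfold pseudoWeight predLabel
  rw [abs_neg]
  split_ifs with h1 h2 h3 h3
  · have : t = 0 := by linarith
    subst this; simp at h1; linarith
  all_goals simp_all
  linarith

section Affine

variable {σ Γ α : ℝ}

lemma pseudoWeight_affine (hσ : 0 < σ) (hΓ : 0 ≤ Γ) (z : ℝ) :
    pseudoWeight Γ (α + σ * z) = (Set.Ioi (thresholdPlus σ Γ α)).indicator 1 z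
      - (Set.Ioi (thresholdMinus σ Γ α)).indicator 1 (-z) := by
  have h1 : thresholdPlus σ Γ α < z ↔ Γ < α + σ * z := by
    rw [thresholdPlus, div_lt_iff₀ hσ]; constructor <;> intro h <;> linarith
  have h2 : thresholdMinus σ Γ α < -z ↔ Γ < -(α + σ * z) := by
    rw [thresholdMinus, div_lt_iff₀ hσ]; constructor <;> intro h <;> linarith
  simp only [Set.indicator_apply, Set.mem_Ioi, h1, h2, pseudoWeight, predLabel, Pi.one_apply,
    lt_abs]
  split_ifs <;> first | linarith | (exfalso; simp_all; done) | (exfalso; simp_all; linarith)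

/-- The two acceptance events `α + σ z > Γ` and `α + σ z < -Γ` are disjoint. -/
lemma pseudoWeight_affine_sq (hσ : 0 < σ) (hΓ : 0 ≤ Γ) (z : ℝ) :
    pseudoWeight Γ (α + σ * z) ^ 2 = (Set.Ioi (thresholdPlus σ Γ α)).indicator 1 z
      + (Set.Ioi (thresholdMinus σ Γ α)).indicator 1 (-z) := by
  have h1 : thresholdPlus σ Γ α < z ↔ Γ < α + σ * z := by
    rw [thresholdPlus, div_lt_iff₀ hσ]; constructor <;> intro h <;> linarith
  have h2 : thresholdMinus σ Γ α < -z ↔ Γ < -(α + σ * z) := by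
    rw [thresholdMinus, div_lt_iff₀ hσ]; constructor <;> intro h <;> linarith
  rw [pseudoWeight_affine hσ hΓ]
  simp only [Set.indicator_apply, Set.mem_Ioi, h1, h2, Pi.one_apply]
  split_ifs <;> linarith

lemma measurable_indicator_Ioi (a : ℝ) :
    Measurable ((Set.Ioi a).indicator (1 : ℝ → ℝ)) :=
  measurable_one.indicator measurableSet_Ioi

lemma integrable_indicator_Ioi_mul (a : ℝ) {f : ℝ → ℝ} (hf : Integrable f (gaussianReal 0 1)) :
    Integrable (fun z => (Set.Ioi a).indicator (1 : ℝ → ℝ) z * f z) (gaussianReal 0 1) ∧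
    Integrable (fun z => (Set.Ioi a).indicator (1 : ℝ → ℝ) (-z) * f z) (gaussianReal 0 1) := by
  have hb : ∀ z, ‖(Set.Ioi a).indicator (1 : ℝ → ℝ) z‖ ≤ 1 := fun z => by
    by_cases hz : z ∈ Set.Ioi a <;> simp [hz]
  exact ⟨hf.bdd_mul (measurable_indicator_Ioi a).aestronglyMeasurable
      (Eventually.of_forall fun z => hb z),
    hf.bdd_mul ((measurable_indicator_Ioi a).comp measurable_neg).aestronglyMeasurable
      (Eventually.of_forall fun z => hb (-z))⟩

lemma integral_pseudoWeight (hσ : 0 < σ) (hΓ : 0 ≤ Γ) :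
    ∫ z, pseudoWeight Γ (α + σ * z) ∂(gaussianReal 0 1)
      = acceptRate σ Γ α * (1 - 2 * errorRate σ Γ α) := by
  have hi := fun a => integrable_indicator_Ioi_mul a (integrable_const (1 : ℝ))
  simp only [mul_one] at hi
  simp_rw [pseudoWeight_affine hσ hΓ]
  rw [integral_sub (hi _).1 (hi _).2, integral_comp_neg_gaussianReal (measurable_indicator_Ioi _),
    integral_indicator_Ioi_gaussianReal, integral_indicator_Ioi_gaussianReal, errorRate]
  have := (acceptRate_pos σ Γ α).ne'
  field_simp
  rw [acceptRate]; ring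

lemma integral_pseudoWeight_sq (hσ : 0 < σ) (hΓ : 0 ≤ Γ) :
    ∫ z, pseudoWeight Γ (α + σ * z) ^ 2 ∂(gaussianReal 0 1) = acceptRate σ Γ α := by
  have hi := fun a => integrable_indicator_Ioi_mul a (integrable_const (1 : ℝ))
  simp only [mul_one] at hi
  simp_rw [pseudoWeight_affine_sq hσ hΓ]
  rw [integral_add (hi _).1 (hi _).2, integral_comp_neg_gaussianReal (measurable_indicator_Ioi _),
    integral_indicator_Ioi_gaussianReal, integral_indicator_Ioi_gaussianReal, acceptRate]

lemma integral_pseudoWeight_mul (hσ : 0 < σ) (hΓ : 0 ≤ Γ) :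
    ∫ z, pseudoWeight Γ (α + σ * z) * z ∂(gaussianReal 0 1)
      = acceptRate σ Γ α * biasFactor σ Γ α := by
  have hi := fun a => integrable_indicator_Ioi_mul a
    (IsGaussian.integrable_id (μ := gaussianReal 0 1))
  simp only [id] at hi
  have hneg : ∀ a : ℝ, ∫ z, (Set.Ioi a).indicator 1 (-z) * z ∂(gaussianReal 0 1)
      = -(1 / √(2 * Real.pi) * Real.exp (-a ^ 2 / 2)) := fun a => by
    rw [← integral_indicator_Ioi_mul_gaussianReal, ← integral_comp_neg_gaussianReal
      (f := fun z => (Set.Ioi a).indicator 1 z * z)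
      ((measurable_indicator_Ioi a).mul measurable_id), ← integral_neg]
    simp
  simp_rw [pseudoWeight_affine hσ hΓ, sub_mul]
  rw [integral_sub (hi _).1 (hi _).2, integral_indicator_Ioi_mul_gaussianReal, hneg, biasFactor]
  have := (acceptRate_pos σ Γ α).ne'
  field_simp
  ring

end Affine

/-! ### Moments of the standard Gaussian vector -/

section StdGaussian

variable {E : Type*} [NormedAddCommGroup E] [InnerProductSpace ℝ E] [FiniteDimensional ℝ E]
  [MeasurableSpace E] [BorelSpace E]

lemma integral_inner_stdGaussian (v : E) : ∫ g, ⟪v, g⟫ ∂(stdGaussian E) = 0 :=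
  integral_strongDual_stdGaussian (innerSL ℝ v)

lemma integral_inner_sq_stdGaussian (v : E) :
    ∫ g, ⟪v, g⟫ ^ 2 ∂(stdGaussian E) = ‖v‖ ^ 2 := by
  have h := variance_dual_stdGaussian (innerSL ℝ v)
  rw [variance_of_integral_eq_zero (X := innerSL ℝ v) (by fun_prop) (integral_inner_stdGaussian v),
    innerSL_apply_norm] at h
  exact h

lemma map_inner_stdGaussian {b : E} (hb : ‖b‖ = 1) :
    (stdGaussian E).map (fun g => ⟪b, g⟫) = gaussianReal 0 1 := by
  have h := IsGaussian.map_eq_gaussianReal (μ := stdGaussian E) (innerSL ℝ b)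
  rw [integral_strongDual_stdGaussian, variance_dual_stdGaussian, innerSL_apply_norm, hb] at h
  simpa using h

lemma integral_comp_inner_stdGaussian {b : E} (hb : ‖b‖ = 1) {f : ℝ → ℝ} (hf : Measurable f) :
    ∫ g, f ⟪b, g⟫ ∂(stdGaussian E) = ∫ z, f z ∂(gaussianReal 0 1) := by
  rw [← map_inner_stdGaussian hb, integral_map (by fun_prop) hf.aestronglyMeasurable]

/-- Integrals of functions of `⟪b, g⟫` against `g`: only the component along `b` survives, since
`g` and its reflection in the line of `b` have the same law and the same inner product with `b`. -/
lemma integral_smul_stdGaussian {b : E} (hb : ‖b‖ = 1) {f : ℝ → ℝ} (hf : Measurable f) {K : ℝ}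
    (hK : ∀ t, |f t| ≤ K) :
    ∫ g, f ⟪b, g⟫ • g ∂(stdGaussian E) = (∫ z, f z * z ∂(gaussianReal 0 1)) • b := by
  have hfm : Measurable fun g : E => f ⟪b, g⟫ := hf.comp (by fun_prop)
  have hi : Integrable (fun g : E => f ⟪b, g⟫ • g) (stdGaussian E) :=
    IsGaussian.integrable_id.bdd_smul K hfm.aestronglyMeasurable
      (Eventually.of_forall fun g => hK _)
  have hib : Integrable (fun g : E => f ⟪b, g⟫ * ⟪b, g⟫) (stdGaussian E) := by
    have := hi.const_inner (𝕜 := ℝ) b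
    simpa only [real_inner_smul_right] using this
  set R := (Submodule.span ℝ {b}).reflection with hR
  have hRg : ∀ g, R g = (2 * ⟪b, g⟫) • b - g := fun g => by
    rw [hR, Submodule.reflection_singleton_apply]
    simp [hb, two_smul, two_mul, add_smul]
  have hRb : ∀ g, ⟪b, R g⟫ = ⟪b, g⟫ := fun g => by
    rw [hRg, inner_sub_right, real_inner_smul_right, real_inner_self_eq_norm_sq, hb]; ring
  have h1 : ∫ g, f ⟪b, g⟫ • g ∂(stdGaussian E)
      = ∫ g, ((2 * (f ⟪b, g⟫ * ⟪b, g⟫)) • b - f ⟪b, g⟫ • g) ∂(stdGaussian E) := by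
    have hm : Measurable fun g : E => f ⟪b, g⟫ • g := hfm.smul measurable_id'
    conv_lhs => rw [← stdGaussian_map R]
    rw [integral_map R.continuous.measurable.aemeasurable hm.aestronglyMeasurable]
    refine integral_congr_ae (Eventually.of_forall fun g => ?_)
    simp only [hRb]
    rw [hRg, smul_sub, smul_smul]
    congr 2; ring
  rw [integral_sub ((hib.const_mul 2).smul_const b) hi, integral_smul_const,
    integral_const_mul] at h1
  have h2 : ∫ g : E, f ⟪b, g⟫ * ⟪b, g⟫ ∂(stdGaussian E)
      = ∫ z, f z * z ∂(gaussianReal 0 1) := by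
    exact integral_comp_inner_stdGaussian hb (hf.mul measurable_id)
  rw [h2] at h1
  have h3 : (2 : ℝ) • ∫ g, f ⟪b, g⟫ • g ∂(stdGaussian E)
      = (2 : ℝ) • ((∫ z, f z * z ∂(gaussianReal 0 1)) • b) := by
    rw [two_smul, smul_smul]
    nth_rewrite 1 [h1]
    abel
  exact smul_right_injective E (two_ne_zero (α := ℝ)) h3

/-- The squared norm of a standard Gaussian vector is a sum of `p` independent squares: its mean is
`p` and its variance is `p` times that of a squared standard Gaussian variable. -/
lemma norm_sq_stdGaussian_moments (p : ℕ) :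
    ∫ g, ‖g‖ ^ 2 ∂(stdGaussian (EuclideanSpace ℝ (Fin p))) = p ∧
    ∫ g, (‖g‖ ^ 2 - p) ^ 2 ∂(stdGaussian (EuclideanSpace ℝ (Fin p)))
      = p * Var[fun z => z ^ 2; gaussianReal 0 1] := by
  have hsq : MemLp (fun z : ℝ => z ^ 2) 2 (gaussianReal 0 1) := by
    refine (memLp_two_iff_integrable_sq (by fun_prop)).2 ?_
    have := (memLp_id_gaussianReal' (μ := 0) (v := 1) 4 (by simp)).integrable_norm_pow
      four_ne_zero
    refine this.congr (Eventually.of_forall fun z => ?_)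
    simp only [id, Real.norm_eq_abs]
    rw [← pow_mul, Even.pow_abs (by decide)]
  have h1 : ∫ z, z ^ 2 ∂(gaussianReal 0 1) = 1 := by
    have h := variance_fun_id_gaussianReal (μ := 0) (v := 1)
    rw [variance_of_integral_eq_zero (by fun_prop) integral_id_gaussianReal] at h
    simpa using h
  have hmean : ∫ x : Fin p → ℝ, ∑ i, x i ^ 2 ∂(Measure.pi fun _ => gaussianReal 0 1) = p := by
    have hi : ∀ i : Fin p, Integrable (fun x : Fin p → ℝ => x i ^ 2)
        (Measure.pi fun _ => gaussianReal 0 1) := fun i =>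
      (hsq.comp_measurePreserving
        (measurePreserving_eval (fun _ : Fin p => gaussianReal 0 1) i)).integrable one_le_two
    rw [integral_finsetSum _ fun i _ => hi i]
    simp_rw [integral_comp_eval (μ := fun _ : Fin p => gaussianReal 0 1) (f := fun z => z ^ 2)
      (by fun_prop), h1]
    simp
  have hvar := variance_sum_pi (μ := fun _ : Fin p => gaussianReal 0 1) (X := fun _ z => z ^ 2)
    fun _ => hsq
  have e : (∑ i : Fin p, fun x : Fin p → ℝ => x i ^ 2) = fun x => ∑ i, x i ^ 2 := by
    ext w; simp
  rw [e, variance_eq_integral (Measurable.aemeasurable (by fun_prop)), hmean] at hvar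
  rw [← map_pi_eq_stdGaussian]
  constructor
  · rw [integral_map (by fun_prop) (by fun_prop)]
    simpa [EuclideanSpace.real_norm_sq_eq] using hmean
  · rw [integral_map (by fun_prop) (by fun_prop)]
    simpa [EuclideanSpace.real_norm_sq_eq] using hvar

end StdGaussian

/-! ### The law of a pseudo-labeled sample -/

/-- The contribution `1(|⟪b, x⟫| > Γ) ŷ(⟪b, x⟫) x` of the sample `x` to the numerator of the
self-training estimator started from `b`. -/
noncomputable def pseudoVector {E : Type*} [NormedAddCommGroup E] [InnerProductSpace ℝ E]
    (Γ : ℝ) (b x : E) : E :=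
  pseudoWeight Γ ⟪b, x⟫ • x

section PseudoVector

variable {E : Type*} [NormedAddCommGroup E] [InnerProductSpace ℝ E]

lemma pseudoVector_neg {Γ : ℝ} (hΓ : 0 ≤ Γ) (b x : E) :
    pseudoVector Γ b (-x) = pseudoVector Γ b x := by
  rw [pseudoVector, inner_neg_right, pseudoWeight_neg hΓ, smul_neg, neg_smul, neg_neg,
    pseudoVector]

lemma norm_pseudoVector_le (Γ : ℝ) (b x : E) : ‖pseudoVector Γ b x‖ ≤ ‖x‖ := by
  rw [pseudoVector, norm_smul]
  exact mul_le_of_le_one_left (norm_nonneg _) (abs_pseudoWeight_le _ _)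

variable [FiniteDimensional ℝ E] [MeasurableSpace E] [BorelSpace E]

lemma measurable_pseudoVector (Γ : ℝ) (b : E) : Measurable (pseudoVector Γ b) :=
  ((measurable_pseudoWeight Γ).comp (by fun_prop : Measurable fun x : E => ⟪b, x⟫)).smul
    measurable_id

end PseudoVector

/-- The mixture components are exchanged by `x ↦ -x`, so an even function has the same law under
the mixture as under its component `N(u, σ² I_p)`. -/
lemma map_gmm_of_even {p : ℕ} (u : EuclideanSpace ℝ (Fin p)) (σ : ℝ) {F : Type*}
    [MeasurableSpace F] {f : EuclideanSpace ℝ (Fin p) → F} (hf : Measurable f)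
    (heven : ∀ x, f (-x) = f x) :
    ((gmm u σ).map Prod.fst).map f
      = (stdGaussian (EuclideanSpace ℝ (Fin p))).map fun g => f (u + σ • g) := by
  have hk : Measurable fun z : ℝ × EuclideanSpace ℝ (Fin p) => f (z.1 • u + σ • z.2) :=
    hf.comp (by fun_prop)
  have hneg : (stdGaussian (EuclideanSpace ℝ (Fin p))).map (fun g => f ((-1 : ℝ) • u + σ • g))
      = (stdGaussian (EuclideanSpace ℝ (Fin p))).map fun g => f (u + σ • g) := by
    conv_rhs => rw [← stdGaussian_map (LinearIsometryEquiv.neg ℝ)]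
    have hm : Measurable fun g => f (u + σ • g) := hf.comp (by fun_prop)
    rw [Measure.map_map hm (LinearIsometryEquiv.continuous _).measurable]
    congr 1
    ext1 g
    rw [Function.comp_apply, ← heven]
    congr 1
    simp [add_comm]
  rw [gmm, Measure.map_map measurable_fst (by fun_prop), Measure.map_map hf (by fun_prop)]
  change (rademacher.prod _).map (fun z => f (z.1 • u + σ • z.2)) = _
  rw [rademacher, Measure.add_prod, Measure.prod_smul_left, Measure.prod_smul_left,
    Measure.dirac_prod, Measure.dirac_prod, Measure.map_add _ _ hk, Measure.map_smul,
    Measure.map_smul, Measure.map_map hk (by fun_prop), Measure.map_map hk (by fun_prop)]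
  simp only [Function.comp_def, one_smul]
  rw [hneg, ← add_smul, ENNReal.inv_two_add_inv_two, one_smul]

/-- The law of the contribution of one unlabeled sample to the self-training estimator started from
`b`; by `map_gmm_of_even` it is enough to sample from the component with label `1`. -/
noncomputable def pseudoLaw {p : ℕ} (σ Γ : ℝ) (u b : EuclideanSpace ℝ (Fin p)) :
    Measure (EuclideanSpace ℝ (Fin p)) :=
  (stdGaussian (EuclideanSpace ℝ (Fin p))).map fun g => pseudoVector Γ b (u + σ • g)

section PseudoLaw

variable {p : ℕ} {σ Γ α : ℝ} {u b : EuclideanSpace ℝ (Fin p)}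

lemma measurable_pseudoVector_affine (σ Γ : ℝ) (u b : EuclideanSpace ℝ (Fin p)) :
    Measurable fun g : EuclideanSpace ℝ (Fin p) => pseudoVector Γ b (u + σ • g) :=
  (measurable_pseudoVector Γ b).comp (by fun_prop)

instance isProbabilityMeasure_pseudoLaw : IsProbabilityMeasure (pseudoLaw σ Γ u b) :=
  Measure.isProbabilityMeasure_map (measurable_pseudoVector_affine σ Γ u b).aemeasurable

lemma integral_pseudoLaw {F : Type*} [NormedAddCommGroup F] [NormedSpace ℝ F]
    {f : EuclideanSpace ℝ (Fin p) → F} (hf : AEStronglyMeasurable f (pseudoLaw σ Γ u b)) :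
    ∫ w, f w ∂(pseudoLaw σ Γ u b)
      = ∫ g, f (pseudoVector Γ b (u + σ • g)) ∂(stdGaussian (EuclideanSpace ℝ (Fin p))) :=
  integral_map (measurable_pseudoVector_affine σ Γ u b).aemeasurable hf

lemma memLp_affine_stdGaussian (σ : ℝ) (u : EuclideanSpace ℝ (Fin p)) :
    MemLp (fun g : EuclideanSpace ℝ (Fin p) => u + σ • g) 4 (stdGaussian _) :=
  (memLp_const u).add ((IsGaussian.memLp_id (stdGaussian _) 4 (by simp)).const_smul σ)

lemma memLp_id_pseudoLaw : MemLp id 4 (pseudoLaw σ Γ u b) := by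
  rw [pseudoLaw, memLp_map_measure_iff (by fun_prop)
    (measurable_pseudoVector_affine σ Γ u b).aemeasurable]
  exact (memLp_affine_stdGaussian σ u).of_le
    (measurable_pseudoVector_affine σ Γ u b).aestronglyMeasurable
    (Eventually.of_forall fun g => norm_pseudoVector_le _ _ _)

lemma pseudoVector_affine (hb : ⟪b, u⟫ = α) (g : EuclideanSpace ℝ (Fin p)) :
    pseudoVector Γ b (u + σ • g) = pseudoWeight Γ (α + σ * ⟪b, g⟫) • (u + σ • g) := by
  rw [pseudoVector, inner_add_right, real_inner_smul_right, hb]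

lemma measurable_pseudoWeight_affine (σ Γ α : ℝ) :
    Measurable fun z => pseudoWeight Γ (α + σ * z) :=
  (measurable_pseudoWeight Γ).comp (by fun_prop)

lemma integral_id_pseudoLaw (hσ : 0 < σ) (hΓ : 0 ≤ Γ) (hb1 : ‖b‖ = 1) (hb : ⟪b, u⟫ = α) :
    ∫ w, w ∂(pseudoLaw σ Γ u b) = acceptRate σ Γ α •
      ((1 - 2 * errorRate σ Γ α) • u + (σ * biasFactor σ Γ α) • b) := by
  have hm := measurable_pseudoWeight_affine σ Γ α
  have hmb : Measurable fun g : EuclideanSpace ℝ (Fin p) => pseudoWeight Γ (α + σ * ⟪b, g⟫) :=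
    hm.comp (by fun_prop)
  have hi1 : Integrable (fun g : EuclideanSpace ℝ (Fin p) => pseudoWeight Γ (α + σ * ⟪b, g⟫))
      (stdGaussian _) :=
    Integrable.of_bound hmb.aestronglyMeasurable 1
      (Eventually.of_forall fun g => abs_pseudoWeight_le _ _)
  have hi2 : Integrable (fun g : EuclideanSpace ℝ (Fin p) =>
      pseudoWeight Γ (α + σ * ⟪b, g⟫) • g) (stdGaussian _) :=
    IsGaussian.integrable_id.bdd_smul 1 hmb.aestronglyMeasurable
      (Eventually.of_forall fun g => abs_pseudoWeight_le _ _)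
  rw [integral_pseudoLaw (f := fun w => w) (by fun_prop)]
  simp_rw [pseudoVector_affine hb, smul_add, smul_comm _ σ]
  rw [integral_add (g := fun g : EuclideanSpace ℝ (Fin p) =>
      σ • pseudoWeight Γ (α + σ * ⟪b, g⟫) • g) (hi1.smul_const u) (hi2.smul σ),
    integral_smul_const, integral_smul,
    integral_comp_inner_stdGaussian hb1 hm, integral_pseudoWeight hσ hΓ,
    integral_smul_stdGaussian hb1 hm (fun t => abs_pseudoWeight_le _ _),
    integral_pseudoWeight_mul hσ hΓ]
  simp only [smul_smul]
  congr 2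
  ring

lemma integral_inner_sq_pseudoLaw_le (hu : ‖u‖ = 1) (v : EuclideanSpace ℝ (Fin p)) :
    ∫ w, ⟪v, w⟫ ^ 2 ∂(pseudoLaw σ Γ u b) ≤ 2 * (1 + σ ^ 2) * ‖v‖ ^ 2 := by
  have h2 : MemLp (fun w : EuclideanSpace ℝ (Fin p) => ⟪v, w⟫) 2 (pseudoLaw σ Γ u b) :=
    memLp_inner_left (memLp_id_pseudoLaw.mono_exponent (by norm_num)) v
  have hi := (integrable_map_measure h2.integrable_sq.aestronglyMeasurable
    (measurable_pseudoVector_affine σ Γ u b).aemeasurable).1 h2.integrable_sq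
  have hg : Integrable (fun g : EuclideanSpace ℝ (Fin p) => ⟪v, g⟫ ^ 2) (stdGaussian _) :=
    (memLp_inner_left IsGaussian.memLp_two_id v).integrable_sq
  rw [integral_pseudoLaw (f := fun w => ⟪v, w⟫ ^ 2) (by fun_prop)]
  calc _ ≤ ∫ g, (2 * ‖v‖ ^ 2 + 2 * σ ^ 2 * ⟪v, g⟫ ^ 2) ∂(stdGaussian _) := by
        refine integral_mono hi ((integrable_const _).add (hg.const_mul _)) fun g => ?_
        have h1 : ⟪v, u⟫ ^ 2 ≤ ‖v‖ ^ 2 := by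
          have := abs_real_inner_le_norm v u
          rw [hu, mul_one] at this
          rw [← sq_abs]
          gcongr
        have h3 : pseudoWeight Γ ⟪b, u + σ • g⟫ ^ 2 ≤ 1 :=
          (sq_le_one_iff_abs_le_one _).2 (abs_pseudoWeight_le _ _)
        simp only [pseudoVector, real_inner_smul_right, inner_add_right, mul_pow]
          at h3 ⊢
        calc _ ≤ 1 * (⟪v, u⟫ + σ * ⟪v, g⟫) ^ 2 := by gcongr
          _ ≤ _ := by nlinarith [sq_nonneg (⟪v, u⟫ - σ * ⟪v, g⟫)]
    _ = _ := by
        rw [integral_add (integrable_const _) (hg.const_mul _), integral_const_mul (2 * σ ^ 2),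
          integral_inner_sq_stdGaussian]
        simp; ring

/-- The variance of a squared standard Gaussian variable. -/
noncomputable def varSqGaussian : ℝ := Var[fun z => z ^ 2; gaussianReal 0 1]

lemma integrable_norm_sq_sub_sq (p : ℕ) :
    Integrable (fun g : EuclideanSpace ℝ (Fin p) => (‖g‖ ^ 2 - p) ^ 2) (stdGaussian _) ∧
    Integrable (fun g : EuclideanSpace ℝ (Fin p) => ‖g‖ ^ 2) (stdGaussian _) ∧
    Integrable (fun g : EuclideanSpace ℝ (Fin p) => ‖g‖ ^ 4) (stdGaussian _) := by
  have h4 : Integrable (fun g : EuclideanSpace ℝ (Fin p) => ‖g‖ ^ 4) (stdGaussian _) :=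
    (IsGaussian.memLp_id (stdGaussian _) 4 (by simp)).integrable_norm_pow four_ne_zero
  have h2 : Integrable (fun g : EuclideanSpace ℝ (Fin p) => ‖g‖ ^ 2) (stdGaussian _) :=
    IsGaussian.memLp_two_id.integrable_norm_pow two_ne_zero
  refine ⟨?_, h2, h4⟩
  refine ((h4.sub (h2.const_mul (2 * p))).add (integrable_const ((p : ℝ) ^ 2))).congr
    (Eventually.of_forall fun g => ?_)
  simp only [Pi.add_apply, Pi.sub_apply]
  ring

lemma integral_norm_pow_four_stdGaussian (p : ℕ) :
    ∫ g, ‖g‖ ^ 4 ∂(stdGaussian (EuclideanSpace ℝ (Fin p))) = p * varSqGaussian + p ^ 2 := by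
  obtain ⟨hi, h2, h4⟩ := integrable_norm_sq_sub_sq p
  obtain ⟨hm, hv⟩ := norm_sq_stdGaussian_moments p
  have e : ∀ g : EuclideanSpace ℝ (Fin p),
      ‖g‖ ^ 4 = (‖g‖ ^ 2 - p) ^ 2 + (2 * p * ‖g‖ ^ 2 - p ^ 2) := fun g => by ring
  simp_rw [e]
  rw [integral_add (g := fun g => 2 * p * ‖g‖ ^ 2 - (p : ℝ) ^ 2) hi
      ((h2.const_mul _).sub (integrable_const _)),
    integral_sub (h2.const_mul _) (integrable_const _), integral_const_mul, hv, hm, varSqGaussian]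
  simp; ring

lemma integral_norm_pow_four_pseudoLaw_le (hu : ‖u‖ = 1) :
    ∫ w, ‖w‖ ^ 4 ∂(pseudoLaw σ Γ u b) ≤ 8 * (1 + σ ^ 4 * (p * varSqGaussian + p ^ 2)) := by
  obtain ⟨-, -, h4⟩ := integrable_norm_sq_sub_sq p
  rw [integral_pseudoLaw (f := fun w => ‖w‖ ^ 4) (by fun_prop)]
  have hb : ∀ g : EuclideanSpace ℝ (Fin p),
      ‖pseudoVector Γ b (u + σ • g)‖ ^ 4 ≤ 8 * (1 + σ ^ 4 * ‖g‖ ^ 4) := fun g => by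
    have h1 : ‖pseudoVector Γ b (u + σ • g)‖ ≤ 1 + |σ| * ‖g‖ := by
      refine (norm_pseudoVector_le _ _ _).trans ((norm_add_le _ _).trans ?_)
      rw [hu, norm_smul, Real.norm_eq_abs]
    have h2 := add_pow_le zero_le_one (mul_nonneg (abs_nonneg σ) (norm_nonneg g)) 4
    norm_num [mul_pow, Even.pow_abs (by decide : Even 4)] at h2
    exact (pow_le_pow_left₀ (norm_nonneg _) h1 4).trans h2
  refine (integral_mono_of_nonneg (Eventually.of_forall fun g => by positivity)
    (((integrable_const _).add (h4.const_mul _)).const_mul 8) (Eventually.of_forall hb)).trans ?_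
  simp only [Pi.add_apply]
  rw [integral_const_mul, integral_add (integrable_const _) (h4.const_mul _), integral_const_mul,
    integral_norm_pow_four_stdGaussian]
  simp

/-- `‖w‖ ^ 2` is the acceptance indicator times `‖u + σ g‖ ^ 2`, and `‖g‖ ^ 2` deviates from `p` by
`O(√p)` only; hence the mean is `σ² p` times the acceptance rate, up to `O(√p)`. -/
lemma abs_integral_norm_sq_pseudoLaw_sub_le (hσ : 0 < σ) (hΓ : 0 ≤ Γ) (hu : ‖u‖ = 1)
    (hb1 : ‖b‖ = 1) (hb : ⟪b, u⟫ = α) :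
    |∫ w, ‖w‖ ^ 2 ∂(pseudoLaw σ Γ u b) - σ ^ 2 * p * acceptRate σ Γ α|
      ≤ 1 + 2 * σ + σ ^ 2 * ((1 + varSqGaussian) / 2 * √p) := by
  obtain ⟨hi4, -, -⟩ := integrable_norm_sq_sub_sq p
  have hm := measurable_pseudoWeight_affine σ Γ α
  have hmb : Measurable fun g : EuclideanSpace ℝ (Fin p) => pseudoWeight Γ (α + σ * ⟪b, g⟫) :=
    hm.comp (by fun_prop)
  have hle : ∀ t, pseudoWeight Γ t ^ 2 ≤ 1 := fun t =>
    (sq_le_one_iff_abs_le_one _).2 (abs_pseudoWeight_le _ _)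
  have hA : Integrable (fun g : EuclideanSpace ℝ (Fin p) =>
      pseudoWeight Γ (α + σ * ⟪b, g⟫) ^ 2) (stdGaussian _) :=
    Integrable.of_bound (hmb.pow_const 2).aestronglyMeasurable 1
      (Eventually.of_forall fun g => by
        rw [Real.norm_of_nonneg (by positivity)]; exact hle _)
  have hρ : ∫ g : EuclideanSpace ℝ (Fin p), pseudoWeight Γ (α + σ * ⟪b, g⟫) ^ 2 ∂(stdGaussian _)
      = acceptRate σ Γ α := by
    rw [← integral_pseudoWeight_sq hσ hΓ]
    exact integral_comp_inner_stdGaussian hb1 (hm.pow_const 2)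
  have hW : Integrable (fun g => ‖pseudoVector Γ b (u + σ • g)‖ ^ 2)
      (stdGaussian (EuclideanSpace ℝ (Fin p))) :=
    ((memLp_map_measure_iff (by fun_prop)
      (measurable_pseudoVector_affine σ Γ u b).aemeasurable).1
      (memLp_id_pseudoLaw.mono_exponent (p := 2) (by norm_num))).integrable_norm_pow two_ne_zero
  -- `p` is positive because the space contains a unit vector
  have hp : 0 < (p : ℝ) := by
    rcases Nat.eq_zero_or_pos p with rfl | h
    · exact absurd hu (by simp [Subsingleton.elim u 0])
    · exact_mod_cast h
  have hs : 0 < √(p : ℝ) := Real.sqrt_pos.2 hp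
  have hss : √(p : ℝ) * √p = p := Real.mul_self_sqrt hp.le
  rw [integral_pseudoLaw (f := fun w => ‖w‖ ^ 2) (by fun_prop), ← hρ, ← integral_const_mul,
    ← integral_sub hW (hA.const_mul _)]
  have hg : Integrable (fun g : EuclideanSpace ℝ (Fin p) => ⟪u, g⟫ ^ 2) (stdGaussian _) :=
    (memLp_inner_left IsGaussian.memLp_two_id u).integrable_sq
  have hpt : ∀ g : EuclideanSpace ℝ (Fin p),
      ‖‖pseudoVector Γ b (u + σ • g)‖ ^ 2 - σ ^ 2 * p * pseudoWeight Γ (α + σ * ⟪b, g⟫) ^ 2‖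
      ≤ (1 + σ + σ ^ 2 * (√p / 2)) + (σ * ⟪u, g⟫ ^ 2
        + σ ^ 2 / (2 * √p) * (‖g‖ ^ 2 - p) ^ 2) := fun g => by
    have e : ‖pseudoVector Γ b (u + σ • g)‖ ^ 2 - σ ^ 2 * p * pseudoWeight Γ (α + σ * ⟪b, g⟫) ^ 2
        = pseudoWeight Γ (α + σ * ⟪b, g⟫) ^ 2
          * (1 + 2 * σ * ⟪u, g⟫ + σ ^ 2 * (‖g‖ ^ 2 - p)) := by
      rw [pseudoVector_affine hb, norm_smul, mul_pow, norm_add_sq_real, hu, norm_smul,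
        real_inner_smul_right, mul_pow]
      simp only [Real.norm_eq_abs, sq_abs]
      ring
    rw [e, Real.norm_eq_abs, abs_mul, abs_of_nonneg (sq_nonneg _)]
    refine (mul_le_of_le_one_left (abs_nonneg _) (hle _)).trans ?_
    have h1 : 2 * |⟪u, g⟫| ≤ 1 + ⟪u, g⟫ ^ 2 := by
      nlinarith [sq_nonneg (|⟪u, g⟫| - 1), sq_abs ⟪u, g⟫]
    -- arithmetic-geometric mean inequality, balanced at deviations of order `√p`
    have h2 : |‖g‖ ^ 2 - p| ≤ √p / 2 + (‖g‖ ^ 2 - p) ^ 2 / (2 * √p) := by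
      rw [← sub_nonneg]
      have : √p / 2 + (‖g‖ ^ 2 - p) ^ 2 / (2 * √p) - |‖g‖ ^ 2 - p|
          = (√p - |‖g‖ ^ 2 - p|) ^ 2 / (2 * √p) := by
        rw [← sq_abs (‖g‖ ^ 2 - (p : ℝ))]; field_simp; ring
      rw [this]; positivity
    calc |1 + 2 * σ * ⟪u, g⟫ + σ ^ 2 * (‖g‖ ^ 2 - p)|
        ≤ 1 + σ * (2 * |⟪u, g⟫|) + σ ^ 2 * |‖g‖ ^ 2 - p| := by
          refine (abs_add_three _ _ _).trans_eq ?_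
          rw [abs_one, abs_mul, abs_mul, abs_mul, abs_of_pos hσ, abs_two,
            abs_of_nonneg (sq_nonneg σ)]
          ring
      _ ≤ 1 + σ * (1 + ⟪u, g⟫ ^ 2)
          + σ ^ 2 * (√p / 2 + (‖g‖ ^ 2 - p) ^ 2 / (2 * √p)) := by gcongr
      _ = _ := by ring
  have hg' : Integrable (fun g : EuclideanSpace ℝ (Fin p) => σ * ⟪u, g⟫ ^ 2
        + σ ^ 2 / (2 * √p) * (‖g‖ ^ 2 - p) ^ 2) (stdGaussian _) :=
    (hg.const_mul _).add (hi4.const_mul _)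
  refine (norm_integral_le_of_norm_le ((integrable_const _).add hg')
    (Eventually.of_forall hpt)).trans_eq ?_
  simp only [Pi.add_apply]
  rw [integral_add (integrable_const _) hg', integral_add (hg.const_mul _) (hi4.const_mul _),
    integral_const_mul, integral_const_mul, integral_inner_sq_stdGaussian, hu,
    (norm_sq_stdGaussian_moments p).2, ← varSqGaussian]
  simp only [integral_const, probReal_univ, one_smul]
  have : σ ^ 2 / (2 * √(p : ℝ)) * (p * varSqGaussian) = σ ^ 2 * varSqGaussian / 2 * √p := by
    nth_rewrite 2 [← hss]; field_simp
  rw [this]; ring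

end PseudoLaw

/-! ### The cotangent of the angle -/

lemma corr_smul_left {p : ℕ} {c : ℝ} (hc : 0 < c) (a b : EuclideanSpace ℝ (Fin p)) :
    corr (c • a) b = corr a b := by
  rw [corr, corr, real_inner_smul_left, norm_smul, Real.norm_of_nonneg hc.le, mul_assoc,
    mul_div_mul_left _ _ hc.ne']

lemma cotAngle_smul_left {p : ℕ} {c : ℝ} {a b : EuclideanSpace ℝ (Fin p)} (h : 0 < c ∨ a = 0) :
    cotAngle (c • a) b = cotAngle a b := by
  rcases h with hc | rfl
  · rw [cotAngle, cotAngle, corr_smul_left hc]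
  · rw [smul_zero]

/-- At `a = 0`, and where the radicand vanishes, both sides take the junk value `0`. -/
lemma cotAngle_eq {p : ℕ} (a : EuclideanSpace ℝ (Fin p)) {u : EuclideanSpace ℝ (Fin p)}
    (hu : ‖u‖ = 1) : cotAngle a u = ⟪u, a⟫ / √(‖a‖ ^ 2 - ⟪u, a⟫ ^ 2) := by
  rcases eq_or_ne a 0 with rfl | ha
  · simp [cotAngle, corr]
  have hn : 0 < ‖a‖ := norm_pos_iff.2 ha
  have h : ‖a‖ ^ 2 - ⟪u, a⟫ ^ 2 = ‖a‖ ^ 2 * (1 - (⟪u, a⟫ / ‖a‖) ^ 2) := by field_simp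
  rw [h, Real.sqrt_mul (sq_nonneg _), Real.sqrt_sq hn.le, ← div_div, cotAngle, corr, hu, mul_one,
    real_inner_comm u a]

/-! ### Self-training and federated distillation -/

/-- The self-training estimator and the empirical mean of the pseudo-labeled accepted samples
differ by a nonnegative factor, which vanishes only if no sample is accepted. -/
lemma cotAngle_selfTraining {p m : ℕ} (Γ : ℝ) {β : EuclideanSpace ℝ (Fin p)}
    (hβ : β ≠ 0) (u : EuclideanSpace ℝ (Fin p)) (x : Fin m → EuclideanSpace ℝ (Fin p)) :
    cotAngle (selfTraining β (Γ * ‖β‖) x) u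
      = cotAngle ((m : ℝ)⁻¹ • ∑ i, pseudoVector Γ (‖β‖⁻¹ • β) (x i)) u := by
  have hn : 0 < ‖β‖ := norm_pos_iff.2 hβ
  have hacc : ∀ z, Γ * ‖β‖ < |⟪β, z⟫| ↔ Γ < |⟪‖β‖⁻¹ • β, z⟫| := fun z => by
    rw [real_inner_smul_left, abs_mul, abs_of_pos (inv_pos.2 hn), inv_mul_eq_div, lt_div_iff₀ hn]
  have hlab : ∀ z, predLabel ⟪β, z⟫ = predLabel ⟪‖β‖⁻¹ • β, z⟫ := fun z => by
    rw [real_inner_smul_left, predLabel, predLabel]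
    simp only [mul_nonneg_iff_of_pos_left (inv_pos.2 hn)]
  have hterm : ∀ z, (if Γ * ‖β‖ < |⟪β, z⟫| then (1 : ℝ) else 0) • (predLabel ⟪β, z⟫ • z)
      = pseudoVector Γ (‖β‖⁻¹ • β) z := fun z => by
    rw [pseudoVector, pseudoWeight, hlab]
    simp only [hacc]
    split_ifs <;> simp
  rw [selfTraining, pseudoLabelAverage]
  simp_rw [hterm]
  rw [cotAngle_smul_left, cotAngle_smul_left]
  · rcases Nat.eq_zero_or_pos m with rfl | hm
    · exact Or.inr (by simp)
    · exact Or.inl (by positivity)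
  · by_cases h : ∃ i, Γ * ‖β‖ < |⟪β, x i⟫|
    · obtain ⟨i, hi⟩ := h
      refine Or.inl (inv_pos.2 (Finset.sum_pos' (fun j _ => by split_ifs <;> simp)
        ⟨i, Finset.mem_univ i, by simp [hi]⟩))
    · push Not at h
      refine Or.inr (Finset.sum_eq_zero fun i _ => ?_)
      rw [← hterm, if_neg (not_lt.2 (h i)), zero_smul]

namespace FederatedData

variable {p : ℕ} (D : FederatedData p)

lemma avgLogit_eq (z : EuclideanSpace ℝ (Fin p)) : D.avgLogit z = ⟪D.serverVector, z⟫ := by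
  simp [avgLogit, serverVector, localLogit, sum_inner, real_inner_smul_left]

lemma serverVector_eq_pooledEstimator : D.serverVector = D.pooledEstimator := by
  rw [serverVector, pooledEstimator, Finset.smul_sum]
  refine Finset.sum_congr rfl fun k _ => ?_
  rw [localEstimator, smul_smul]
  -- a client without samples contributes `0` to both sides
  rcases Nat.eq_zero_or_pos (D.size k) with h | h
  · have : IsEmpty (Fin (D.size k)) := by rw [h]; infer_instance
    simp
  · congr 1
    field_simp

lemma fdEstimator_eq_selfTraining (Γ : ℝ) {m : ℕ} (x : Fin m → EuclideanSpace ℝ (Fin p)) :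
    D.fdEstimator Γ x = selfTraining D.serverVector Γ x := by
  rw [fdEstimator, selfTraining, funext D.avgLogit_eq]

end FederatedData

lemma corr_eq_inner_normalize {p : ℕ} (β : EuclideanSpace ℝ (Fin p)) {u : EuclideanSpace ℝ (Fin p)}
    (hu : ‖u‖ = 1) : ⟪‖β‖⁻¹ • β, u⟫ = corr β u := by
  rw [corr, hu, mul_one, real_inner_smul_left, inv_mul_eq_div]

/-- The contributions of the unlabeled samples are independent with law `pseudoLaw`. -/
lemma map_unlabeledLaw {p : ℕ} {Γ : ℝ} (hΓ : 0 ≤ Γ) (u b : EuclideanSpace ℝ (Fin p)) (σ : ℝ)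
    (m : ℕ) : (unlabeledLaw u σ m).map (fun x i => pseudoVector Γ b (x i))
      = Measure.pi fun _ : Fin m => pseudoLaw σ Γ u b := by
  have h : ((gmm u σ).map Prod.fst).map (pseudoVector Γ b) = pseudoLaw σ Γ u b :=
    map_gmm_of_even u σ (measurable_pseudoVector Γ b) (pseudoVector_neg hΓ b)
  have : ∀ _ : Fin m, SigmaFinite (((gmm u σ).map Prod.fst).map (pseudoVector Γ b)) :=
    fun _ => by rw [h]; infer_instance
  rw [unlabeledLaw, Measure.pi_map_pi (hμ := this)
    fun _ => (measurable_pseudoVector Γ b).aemeasurable]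
  simp_rw [h]

section Limit

variable {σ Γ α ubar : ℝ}

lemma limitCot_radicand_pos (hub : 0 < ubar) (hα : |α| ≤ 1) :
    0 < (1 - α ^ 2) * biasFactor σ Γ α ^ 2 + 1 / (ubar * acceptRate σ Γ α) := by
  have h1 : 0 ≤ 1 - α ^ 2 := sub_nonneg.2 ((sq_le_one_iff_abs_le_one α).2 hα)
  have h2 := acceptRate_pos σ Γ α
  positivity

/-- The limits of `⟪W, u⟫` and `‖W‖ ^ 2` combine to `limitCot`. -/
lemma limitCot_eq (hσ : 0 < σ) :
    limitCot σ Γ α ubar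
      = acceptRate σ Γ α * (1 - 2 * errorRate σ Γ α + σ * biasFactor σ Γ α * α) /
        √(acceptRate σ Γ α ^ 2 * σ ^ 2 *
          ((1 - α ^ 2) * biasFactor σ Γ α ^ 2 + 1 / (ubar * acceptRate σ Γ α))) := by
  have h2 := acceptRate_pos σ Γ α
  rw [limitCot, Real.sqrt_mul (by positivity), ← mul_pow, Real.sqrt_sq (by positivity),
    mul_assoc (acceptRate σ Γ α) σ, mul_div_mul_left _ _ h2.ne']
  congr 1
  ring

/-- The moments of `pseudoLaw` in the proportional regime `m / p → ubar`. -/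
lemma tendsto_pseudoLaw_moments (hσ : 0 < σ) (hΓ : 0 ≤ Γ) (hub : 0 < ubar) {p m : ℕ → ℕ}
    (hp : Tendsto p atTop atTop)
    (hmp : Tendsto (fun j => (m j : ℝ) / (p j : ℝ)) atTop (𝓝 ubar))
    {u b : ∀ j, EuclideanSpace ℝ (Fin (p j))} (hu : ∀ j, ‖u j‖ = 1) (hb1 : ∀ j, ‖b j‖ = 1)
    (hb : ∀ j, ⟪b j, u j⟫ = α) :
    Tendsto m atTop atTop ∧
    Tendsto (fun j => (∫ w, ‖w‖ ^ 2 ∂(pseudoLaw σ Γ (u j) (b j))) / m j) atTop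
      (𝓝 (σ ^ 2 * acceptRate σ Γ α / ubar)) ∧
    Tendsto (fun j => (∫ w, ‖w‖ ^ 4 ∂(pseudoLaw σ Γ (u j) (b j))) / (m j : ℝ) ^ 3) atTop
      (𝓝 0) := by
  have hpR : Tendsto (fun j => (p j : ℝ)) atTop atTop := tendsto_natCast_atTop_atTop.comp hp
  have hpinv : Tendsto (fun j => (p j : ℝ)⁻¹) atTop (𝓝 0) := hpR.inv_tendsto_atTop
  have hsinv : Tendsto (fun j => (√(p j : ℝ))⁻¹) atTop (𝓝 0) :=
    (Real.tendsto_sqrt_atTop.comp hpR).inv_tendsto_atTop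
  have hp0 : ∀ᶠ j in atTop, 0 < (p j : ℝ) := hpR.eventually_gt_atTop 0
  have hratio : Tendsto (fun j => (p j : ℝ) / m j) atTop (𝓝 ubar⁻¹) := by
    simpa using hmp.inv₀ hub.ne'
  refine ⟨?_, ?_, ?_⟩
  · refine tendsto_natCast_atTop_iff (R := ℝ).1 ?_
    refine (hmp.pos_mul_atTop hub hpR).congr' ?_
    filter_upwards [hp0] with j hj
    field_simp
  · have hlim : Tendsto (fun j => (∫ w, ‖w‖ ^ 2 ∂(pseudoLaw σ Γ (u j) (b j))) / p j) atTop
        (𝓝 (σ ^ 2 * acceptRate σ Γ α)) := by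
      have hbd : Tendsto (fun j => (1 + 2 * σ) * (p j : ℝ)⁻¹
          + σ ^ 2 * ((1 + varSqGaussian) / 2) * (√(p j : ℝ))⁻¹) atTop (𝓝 0) := by
        simpa using (hpinv.const_mul (1 + 2 * σ)).add
          (hsinv.const_mul (σ ^ 2 * ((1 + varSqGaussian) / 2)))
      rw [tendsto_iff_dist_tendsto_zero]
      refine squeeze_zero' (Eventually.of_forall fun j => dist_nonneg) ?_ hbd
      filter_upwards [hp0] with j hj
      have h := abs_integral_norm_sq_pseudoLaw_sub_le hσ hΓ (hu j) (hb1 j) (hb j)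
      have e : (∫ w, ‖w‖ ^ 2 ∂(pseudoLaw σ Γ (u j) (b j))) / p j - σ ^ 2 * acceptRate σ Γ α
          = (∫ w, ‖w‖ ^ 2 ∂(pseudoLaw σ Γ (u j) (b j)) - σ ^ 2 * p j * acceptRate σ Γ α)
            * (p j : ℝ)⁻¹ := by field_simp
      have hs : (√(p j : ℝ))⁻¹ = √(p j : ℝ) * (p j : ℝ)⁻¹ := by
        nth_rewrite 3 [← Real.mul_self_sqrt hj.le]
        have := Real.sqrt_pos.2 hj
        field_simp
      rw [Real.dist_eq, e, abs_mul, abs_of_pos (inv_pos.2 hj), hs]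
      refine (mul_le_mul_of_nonneg_right h (inv_nonneg.2 hj.le)).trans_eq ?_
      ring
    have := hlim.mul hratio
    rw [← div_eq_mul_inv] at this
    refine this.congr' ?_
    filter_upwards [hp0] with j hj
    field_simp
  · have hbd : Tendsto (fun j => 8 * ((p j : ℝ)⁻¹ ^ 3 + σ ^ 4 * (varSqGaussian * (p j : ℝ)⁻¹ ^ 2
        + (p j : ℝ)⁻¹)) * ((p j : ℝ) / m j) ^ 3) atTop (𝓝 0) := by
      have h := ((((hpinv.pow 3).add ((((hpinv.pow 2).const_mul varSqGaussian).add
        hpinv).const_mul (σ ^ 4))).const_mul 8).mul (hratio.pow 3))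
      simpa using h
    refine squeeze_zero' (Eventually.of_forall fun j =>
      div_nonneg (integral_nonneg fun w => by positivity) (by positivity)) ?_ hbd
    filter_upwards [hp0] with j hj
    calc _ ≤ 8 * (1 + σ ^ 4 * (p j * varSqGaussian + (p j : ℝ) ^ 2)) / (m j : ℝ) ^ 3 := by
          gcongr
          exact integral_norm_pow_four_pseudoLaw_le (hu j)
      _ = _ := by field_simp

end Limit

theorem theorem1 :
    -- the federated distillation step coincides with self-training on the pooled labeled data
    (∀ (p : ℕ) (D : FederatedData p),
      (∀ z : EuclideanSpace ℝ (Fin p), D.avgLogit z = ⟪D.serverVector, z⟫) ∧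
      D.serverVector = D.pooledEstimator ∧
      ∀ (Γ : ℝ) (m : ℕ) (x : Fin m → EuclideanSpace ℝ (Fin p)),
        D.fdEstimator Γ x = selfTraining D.pooledEstimator Γ x) ∧
    -- convergence in probability of the cotangent
    (∀ (σ Γ α ubar : ℝ), 0 < σ → 0 ≤ Γ → 0 < α → 0 < ubar →
      ∀ (p m : ℕ → ℕ), Tendsto p atTop atTop →
        Tendsto (fun j => (m j : ℝ) / (p j : ℝ)) atTop (𝓝 ubar) →
      ∀ (u : ∀ j, EuclideanSpace ℝ (Fin (p j))) (D : ∀ j, FederatedData (p j)),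
        (∀ j, ‖u j‖ = 1) → (∀ j, corr (D j).serverVector (u j) = α) →
      ∀ ε : ℝ, 0 < ε →
        Tendsto (fun j => unlabeledLaw (u j) σ (m j)
            {x | ε ≤ |cotAngle ((D j).fdEstimator (Γ * ‖(D j).serverVector‖) x) (u j)
              - limitCot σ Γ α ubar|})
          atTop (𝓝 0)) := by
  refine ⟨fun p D => ⟨D.avgLogit_eq, D.serverVector_eq_pooledEstimator, fun Γ m x => ?_⟩, ?_⟩
  · rw [D.fdEstimator_eq_selfTraining, D.serverVector_eq_pooledEstimator]
  intro σ Γ α ubar hσ hΓ hα hub p m hp hmp u D hu hcorr ε hε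
  set b : ∀ j, EuclideanSpace ℝ (Fin (p j)) :=
    fun j => ‖(D j).serverVector‖⁻¹ • (D j).serverVector with hbdef
  have hβ : ∀ j, (D j).serverVector ≠ 0 := fun j h => by
    have := hcorr j
    rw [h, corr, inner_zero_left, zero_div] at this
    exact hα.ne this
  have hb1 : ∀ j, ‖b j‖ = 1 := fun j => norm_smul_inv_norm (𝕜 := ℝ) (hβ j)
  have hb : ∀ j, ⟪b j, u j⟫ = α := fun j => by
    rw [hbdef, corr_eq_inner_normalize _ (hu j), hcorr j]
  have hα1 : |α| ≤ 1 := by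
    rw [← hb 0]
    simpa [hb1 0, hu 0] using abs_real_inner_le_norm (b 0) (u 0)
  obtain ⟨hm, hq, hq4⟩ := tendsto_pseudoLaw_moments (Γ := Γ) hσ hΓ hub hp hmp hu hb1 hb
  have hmean := fun j => integral_id_pseudoLaw hσ hΓ (hb1 j) (hb j)
  set ρ := acceptRate σ Γ α with hρ
  set ν := errorRate σ Γ α with hν
  set Λ := biasFactor σ Γ α with hΛ
  have hρ0 : 0 < ρ := acceptRate_pos σ Γ α
  obtain ⟨hX, hY⟩ := tendstoInProb_empiricalMean_vector
    (ν := fun j => pseudoLaw σ Γ (u j) (b j)) (m := m) hm hu (C := 2 * (1 + σ ^ 2))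
    (c₁ := ρ * (1 - 2 * ν + σ * Λ * α))
    (c₂ := ρ ^ 2 * ((1 - 2 * ν) ^ 2 + 2 * (1 - 2 * ν) * (σ * Λ) * α + (σ * Λ) ^ 2))
    (fun j => memLp_id_pseudoLaw) (by positivity)
    (fun j v => integral_inner_sq_pseudoLaw_le (hu j) v)
    (fun j => by
      rw [hmean j, real_inner_smul_right, inner_add_right, real_inner_smul_right,
        real_inner_smul_right, real_inner_self_eq_norm_sq, hu j, real_inner_comm, hb j]
      ring)
    (fun j => by
      rw [hmean j, norm_smul, mul_pow, norm_add_sq_real, norm_smul, norm_smul, hu j, hb1 j,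
        real_inner_smul_left, real_inner_smul_right, real_inner_comm, hb j]
      simp only [Real.norm_eq_abs, mul_one, sq_abs]
      ring)
    hq hq4
  have hrad : ρ ^ 2 * ((1 - 2 * ν) ^ 2 + 2 * (1 - 2 * ν) * (σ * Λ) * α + (σ * Λ) ^ 2)
        + σ ^ 2 * ρ / ubar - (ρ * (1 - 2 * ν + σ * Λ * α)) ^ 2
      = ρ ^ 2 * σ ^ 2 * ((1 - α ^ 2) * Λ ^ 2 + 1 / (ubar * ρ)) := by
    field_simp
    ring
  have hpos : 0 < ρ ^ 2 * σ ^ 2 * ((1 - α ^ 2) * Λ ^ 2 + 1 / (ubar * ρ)) :=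
    mul_pos (by positivity) (limitCot_radicand_pos hub hα1)
  have hcot := hX.map₂ (F := fun s t => s / √(t - s ^ 2)) (by
    refine ContinuousAt.div continuousAt_fst (by fun_prop) ?_
    simp only
    rw [hrad]
    exact (Real.sqrt_pos.2 hpos).ne') hY
  rw [hrad, ← limitCot_eq hσ] at hcot
  refine tendsto_of_tendsto_of_tendsto_of_le_of_le tendsto_const_nhds (hcot ε hε)
    (fun _ => zero_le) fun j => ?_
  have hmeas : Measurable fun (x : Fin (m j) → EuclideanSpace ℝ (Fin (p j))) i =>
      pseudoVector Γ (b j) (x i) :=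
    measurable_pi_lambda _ fun i => (measurable_pseudoVector Γ (b j)).comp (measurable_pi_apply i)
  simp only
  rw [← map_unlabeledLaw hΓ]
  refine le_trans (measure_mono fun x hx => ?_) (Measure.le_map_apply hmeas.aemeasurable _)
  simp only [Set.mem_preimage, Set.mem_ofPred_eq] at hx ⊢
  rwa [← cotAngle_eq _ (hu j), ← cotAngle_selfTraining Γ (hβ j),
    ← FederatedData.fdEstimator_eq_selfTraining]
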